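/- Let $W\ge 0$ be a random variable with mean $\mu$ and variance $\sigma^2\in(0,\infty)$. Let $W^s$ have the $W$-size biased distribution, i.e. $\mathbb{E}[Wf(W)]=\mu\,\mathbb{E}f(W^s)$ for all measurable $f$ with $\mathbb{E}|Wf(W)|<\infty$, and let $W^z$ have the $W$-zero biased distribution, i.e. $\mathbb{E}[(W-\mu)f(W)]=\sigma^2\,\mathbb{E}f'(W^z)$ for all differentiable $f:\mathbb{R}\to\mathbb{R}$ with $\mathbb{E}|Wf(W)|<\infty$ and $\mathbb{E}|f'(W^z)|<\infty$. Write $\mathscr{L}(X)$ for the law of $X$, and put $$d_{\mathrm W}(\mathscr{L}(X),\mathscr{L}(Y))=\sup_{f}|\mathbb{E}f(X)-\mathbb{E}f(Y)|\in[0,\infty],$$ the supremum being over all $f:\mathbb{R}\to\mathbb{R}$ with $|f(x)-f(y)|\le|x-y|$ for all $x,y\in\mathbb{R}$ for which both expectations exist and are finite, and $$d_{\mathrm K}(\mathscr{L}(X),\mathscr{L}(Y))=\sup_{z\in\mathbb{R}}|\mathbb{P}(X\le z)-\mathbb{P}(Y\le z)|.$$ Let $\Gamma(r,\alpha)$ be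 the gamma distribution with density $\frac{1}{\Gamma(r)}\alpha^r x^{r-1}e^{-\alpha x}$, $x>0$. Then, with $\alpha=\mu/\sigma^2$, $r=\mu^2/\sigma^2$, $\Theta=d_{\mathrm W}(\mathscr{L}(W^s),\mathscr{L}(W^z))$ and $r\wedge 1=\min(r,1)$, $$d_{\mathrm W}(\mathscr{L}(W),\Gamma(r,\alpha))\le 8\sqrt{\frac{3\mu}{r+2}}\,\Theta^{1/2}+\frac{8r}{r+2}\,\Theta,$$ $$d_{\mathrm K}(\mathscr{L}(W),\Gamma(r,\alpha))\le a_{r,\alpha}\,\Theta^{\frac{r\wedge1}{r\wedge1+2}}+b_{r,\alpha}\,\Theta^{\frac{r\wedge1+1}{r\wedge1+2}},$$ where $$a_{r,\alpha}=\begin{cases}\left(\frac12+\frac1r\right)\left(\frac{48\mu}{r+2}\right)^{\frac{r}{r+2}}\left[\frac{\alpha^r}{\Gamma(r)}\right]^{\frac{2}{r+2}},&0<r<1,\\[2mm] 3\left(\frac{6\mu}{r+2}\right)^{1/3}\left[\frac{\alpha}{\Gamma(r)}\left(\frac{r-1}{e}\right)^{r-1}\right]^{2/3},&r\ge1,\end{cases}$$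 $$b_{r,\alpha}=\begin{cases}8\alpha\left(\frac{\mu}{r+2}\right)^{\frac{r+1}{r+2}}\left[\frac{\alpha^r}{48\,\Gamma(r)}\right]^{\frac{1}{r+2}},&0<r<1,\\[2mm] 4\alpha\left(\frac{\mu}{r+2}\right)^{2/3}\left[\frac{\alpha}{6\,\Gamma(r)}\left(\frac{r-1}{e}\right)^{r-1}\right]^{1/3},&r\ge1,\end{cases}$$ with the convention $0^0=1$ (relevant for $r=1$). If $\Theta=\infty$ the right-hand sides are $\infty$. -/

import Mathlib

open MeasureTheory ProbabilityTheory
open scoped ENNReal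

noncomputable section

/-- The integral probability metric generated by a class `F` of real functions,
`sup_{f ∈ F} |∫ f dρ - ∫ f dν|`, the supremum being over those `f ∈ F` for which both
expectations exist. It takes values in `[0, ∞]`. -/
def ipm (F : Set (ℝ → ℝ)) (ρ ν : Measure ℝ) : ℝ≥0∞ :=
  ⨆ (f : ℝ → ℝ) (_ : f ∈ F) (_ : Integrable f ρ) (_ : Integrable f ν),
    ENNReal.ofReal |(∫ x, f x ∂ρ) - ∫ x, f x ∂ν|

/-- The Wasserstein distance between laws on `ℝ`: test functions with Lipschitz constant at most `1`.
If exactly one of two probability laws has a finite first absolute moment, the value is `∞`,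
as is seen from the bounded test functions `x ↦ min |x| n`. -/
def wassersteinDist (ρ ν : Measure ℝ) : ℝ≥0∞ :=
  ipm {f | ∀ x y, |f x - f y| ≤ |x - y|} ρ ν

/-- The Kolmogorov distance between laws on `ℝ`: test functions `1_{· ≤ z}`, `z ∈ ℝ`. -/
def kolmogorovDist (ρ ν : Measure ℝ) : ℝ≥0∞ :=
  ipm {f | ∃ z : ℝ, f = (Set.Iic z).indicator (fun _ => 1)} ρ ν

/-- `ν` is the `V`-size biased distribution: `E[V f(V)] = E[V] ∫ f dν` for all (measurable) `f`
with `E|V f(V)| < ∞`. -/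
def IsSizeBiased {Ω : Type*} [MeasurableSpace Ω] (V : Ω → ℝ) (P : Measure Ω) (ν : Measure ℝ) :
    Prop :=
  ∀ f : ℝ → ℝ, Measurable f → Integrable (fun ω => V ω * f (V ω)) P →
    Integrable f ν ∧ ∫ ω, V ω * f (V ω) ∂P = (∫ ω, V ω ∂P) * ∫ x, f x ∂ν

/-- `ν` is the `V`-zero biased distribution: `E[(V - E V) f(V)] = Var(V) ∫ f' dν` for all
differentiable `f` with `E|V f(V)| < ∞`. The identity is required where its right-hand side exists,
that is when `f'` is `ν`-integrable (the derivative of a differentiable function need not be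
locally integrable). -/
def IsZeroBiased {Ω : Type*} [MeasurableSpace Ω] (V : Ω → ℝ) (P : Measure Ω) (ν : Measure ℝ) :
    Prop :=
  ∀ f : ℝ → ℝ, Differentiable ℝ f → Integrable (fun ω => V ω * f (V ω)) P →
    Integrable (deriv f) ν →
    ∫ ω, (V ω - ∫ ω', V ω' ∂P) * f (V ω) ∂P = variance V P * ∫ x, deriv f x ∂ν

/-- The constant `a_{r,α}`, where `m` is the mean. -/
def kolConstA (r α m : ℝ) : ℝ :=
  if r < 1 then
    (1 / 2 + 1 / r) * (48 * m / (r + 2)) ^ (r / (r + 2)) *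
      (α ^ r / Real.Gamma r) ^ (2 / (r + 2))
  else
    3 * (6 * m / (r + 2)) ^ (1 / 3 : ℝ) *
      (α / Real.Gamma r * ((r - 1) / Real.exp 1) ^ (r - 1)) ^ (2 / 3 : ℝ)

/-- The constant `b_{r,α}`, where `m` is the mean. -/
def kolConstB (r α m : ℝ) : ℝ :=
  if r < 1 then
    8 * α * (m / (r + 2)) ^ ((r + 1) / (r + 2)) *
      (α ^ r / (48 * Real.Gamma r)) ^ (1 / (r + 2))
  else
    4 * α * (m / (r + 2)) ^ (2 / 3 : ℝ) *
      (α / (6 * Real.Gamma r) * ((r - 1) / Real.exp 1) ^ (r - 1)) ^ (1 / 3 : ℝ)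

end

/-!
Stein's method for the gamma law. For `W ≥ 0` with mean `μ` and variance `σ²`, put `α = μ / σ²` and
`r = αμ`, and let `f` solve the gamma Stein equation
`x f'(x) + (r - αx) f(x) = h(x) - ∫ h dΓ(r, α)` on `[0, ∞)`. Since `r - αx = -α (x - μ)` and
`ασ² = μ`, the size biased law `Wˢ` and the zero biased law `Wᶻ` give
`E h(W) - ∫ h dΓ(r, α) = μ (E f'(Wˢ) - E f'(Wᶻ))`, which is at most `μ Θ` times the Lipschitz constant
of `f'` (`abs_integral_sub_gamma_le`). It remains to bound that constant and to pass from smooth `h`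
to the test functions of the two metrics.

*Bound on `f''`* (`exists_stein_solution_Ioi`). If `|h'| ≤ L` and `|h''| ≤ L₂`, then
`|f''| ≤ (2 L₂ + 8 α L) / (r + 2)`. Writing the solution through the distribution function of
`Γ(r, α)` gives `|f| ≤ L / α` and `|f'| ≤ 2 L` (`gamma_kernel_bounds`). Differentiating the equation
gives `x f'' + (r + 1 - αx) f' = h' + αf`, whose right-hand side is at most `2 L`. A comparison
principle for equations of this shape (`sub_mul_abs_le_of_stein_eq`, `mul_sub_abs_le_of_stein_eq`)
bounds `(r + 1 - αx) f'` by `2 L`, hence `x f''` by `4 L`, which suffices for `2 αx ≥ r + 2`. For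
`2 αx ≤ r + 2` the equation is differentiated again,
`x f''' + (r + 2 - αx) f'' = h'' + 2 α f'`, and the comparison principle is applied to `f''`.

*Wasserstein distance.* A Lipschitz test function is replaced by its double moving average over
windows of length `b` (`exists_smoothing`), at a cost of order `b`, with `L₂ = 2 L / b`.

*Kolmogorov distance.* The indicator of a half-line is replaced by a ramp of slope `-1 / ε`, which is
smoothed on the scale `ε / 4`. As the distribution function of `Γ(r, α)` has the concave modulus of
continuity `u ↦ K u ^ s / s` with `s = min r 1` (`exists_gamma_modulus`), this costs only
`K ε ^ s / s`, where `ε` is the shift of the centre of the ramp and not its full extent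
(`integral_ramp_le`, `le_integral_ramp`). The stated constants come from
`ε ^ (s + 2) = 48 μ Θ / ((r + 2) K)`.
-/

open Set Filter Topology

/-! ### The gamma law -/

/-- The function `x ↦ x p(x)`, where `p` is the gamma density. It vanishes on `(-∞, 0]`. -/
noncomputable def gammaWeight (r α x : ℝ) : ℝ := x * gammaPDFReal r α x

section GammaLaw

variable {r α : ℝ}

lemma gammaWeight_eq (x : ℝ) (hx : 0 < x) :
    gammaWeight r α x = α ^ r / Real.Gamma r * (x ^ r * Real.exp (-α * x)) := by
  have : x ^ r = x * x ^ (r - 1) := by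
    rw [Real.rpow_sub_one hx.ne']; field_simp
  rw [gammaWeight, gammaPDFReal, if_pos hx.le, this]
  ring_nf

lemma gammaWeight_pos (hr : 0 < r) (hα : 0 < α) {x : ℝ} (hx : 0 < x) : 0 < gammaWeight r α x :=
  mul_pos hx (gammaPDFReal_pos hr hα hx)

lemma hasDerivAt_gammaWeight {x : ℝ} (hx : 0 < x) :
    HasDerivAt (gammaWeight r α) ((r - α * x) * gammaPDFReal r α x) x := by
  have h1 : HasDerivAt (fun x : ℝ => α ^ r / Real.Gamma r * (x ^ r * Real.exp (-α * x)))
      (α ^ r / Real.Gamma r * ((r * x ^ (r - 1)) * Real.exp (-α * x) +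
        x ^ r * (Real.exp (-α * x) * (-α * 1)))) x :=
    ((Real.hasDerivAt_rpow_const (Or.inl hx.ne')).mul
      (((hasDerivAt_id x).const_mul (-α)).exp)).const_mul _
  have h2 := h1.congr_of_eventuallyEq (f₁ := gammaWeight r α)
    (by filter_upwards [lt_mem_nhds hx] with y hy using gammaWeight_eq y hy)
  refine h2.congr_deriv ?_
  have : x ^ r = x * x ^ (r - 1) := by
    rw [Real.rpow_sub_one hx.ne']; field_simp
  rw [gammaPDFReal, if_pos hx.le, this]
  ring_nf

lemma tendsto_gammaWeight_atTop (hα : 0 < α) : Tendsto (gammaWeight r α) atTop (𝓝 0) := by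
  have h := (tendsto_rpow_mul_exp_neg_mul_atTop_nhds_zero r α hα).const_mul
    (α ^ r / Real.Gamma r)
  rw [mul_zero] at h
  refine h.congr' ?_
  filter_upwards [eventually_gt_atTop 0] with x hx using (gammaWeight_eq x hx).symm

lemma continuousWithinAt_gammaWeight_zero (hr : 0 < r) :
    ContinuousWithinAt (gammaWeight r α) (Ici 0) 0 := by
  have h : Continuous fun x : ℝ => α ^ r / Real.Gamma r * (x ^ r * Real.exp (-α * x)) := by
    have := Real.continuous_rpow_const hr.le
    fun_prop
  refine h.continuousWithinAt.congr (fun x hx => ?_) ?_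
  · rcases (mem_Ici.1 hx).eq_or_lt with h0 | h0
    · subst h0; simp [gammaWeight, Real.zero_rpow hr.ne']
    · exact gammaWeight_eq x h0
  · simp [gammaWeight, Real.zero_rpow hr.ne']

lemma gammaPDF_lt_top_ae {ν : Measure ℝ} : ∀ᵐ x ∂ν, gammaPDF r α x < ⊤ :=
  ae_of_all _ fun _ => ENNReal.ofReal_lt_top

lemma measurable_gammaPDF : Measurable (gammaPDF r α) :=
  (measurable_gammaPDFReal r α).ennreal_ofReal

lemma toReal_gammaPDF (hr : 0 < r) (hα : 0 < α) (x : ℝ) :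
    (gammaPDF r α x).toReal = gammaPDFReal r α x :=
  ENNReal.toReal_ofReal (gammaPDFReal_nonneg hr hα x)

lemma setIntegral_gammaMeasure (hr : 0 < r) (hα : 0 < α) (φ : ℝ → ℝ) {s : Set ℝ}
    (hs : MeasurableSet s) :
    ∫ x in s, φ x ∂gammaMeasure r α = ∫ x in s, φ x * gammaPDFReal r α x := by
  have h := setIntegral_withDensity_eq_setIntegral_toReal_smul (μ := volume)
    (measurable_gammaPDF (r := r) (α := α)) gammaPDF_lt_top_ae φ hs
  rw [gammaMeasure, show gammaPDF r α = fun x => gammaPDF r α x from rfl, h]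
  simp only [toReal_gammaPDF hr hα, smul_eq_mul, mul_comm]

lemma integrable_gammaMeasure_iff (hr : 0 < r) (hα : 0 < α) (φ : ℝ → ℝ) :
    Integrable φ (gammaMeasure r α) ↔ Integrable fun x => φ x * gammaPDFReal r α x := by
  rw [gammaMeasure, integrable_withDensity_iff_integrable_smul' measurable_gammaPDF
    gammaPDF_lt_top_ae]
  simp only [toReal_gammaPDF hr hα, smul_eq_mul, mul_comm]

lemma gammaMeasure_Iic_zero (r α : ℝ) : gammaMeasure r α (Iic 0) = 0 := by
  rw [gammaMeasure, withDensity_apply _ measurableSet_Iic, ← lintegral_gammaPDF_of_nonpos le_rfl]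
  exact setLIntegral_congr Iio_ae_eq_Iic.symm

lemma ae_gammaMeasure_pos (r α : ℝ) : ∀ᵐ x ∂gammaMeasure r α, 0 < x := by
  rw [ae_iff]
  simp only [not_lt]
  exact gammaMeasure_Iic_zero r α

lemma integrable_id_gammaMeasure (hr : 0 < r) (hα : 0 < α) :
    Integrable (fun x => x) (gammaMeasure r α) := by
  rw [integrable_gammaMeasure_iff hr hα]
  have h0 : IntegrableOn (fun x : ℝ => x ^ (r + 1 - 1) * Real.exp (-(α * x))) (Ioi 0) := by
    refine Integrable.of_integral_ne_zero ?_
    rw [Real.integral_rpow_mul_exp_neg_mul_Ioi (by linarith) hα]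
    have := Real.Gamma_pos_of_pos (show 0 < r + 1 by linarith)
    positivity
  have h1 : IntegrableOn (gammaWeight r α) (Ioi 0) := by
    refine IntegrableOn.congr_fun (h0.const_mul (α ^ r / Real.Gamma r)) (fun x hx => ?_)
      measurableSet_Ioi
    simp only [gammaWeight_eq x hx, neg_mul, add_sub_cancel_right]
  refine (integrableOn_iff_integrable_of_support_subset fun x hx => ?_).1 h1
  by_contra hx'
  apply hx
  rcases (not_lt.1 (mem_Ioi.not.1 hx')).eq_or_lt with h | h
  · simp [h]
  · simp [gammaPDFReal, not_le.2 h]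

/-- Integrating `p`'s differential equation `(x p)' = (r - αx) p` over `(x, ∞)`. -/
lemma setIntegral_Ioi_sub_gammaMeasure (hr : 0 < r) (hα : 0 < α) {x : ℝ} (hx : 0 ≤ x) :
    ∫ u in Ioi x, (r - α * u) ∂gammaMeasure r α = -gammaWeight r α x := by
  have := isProbabilityMeasure_gammaMeasure hr hα
  have hi : Integrable (fun u => r - α * u) (gammaMeasure r α) :=
    (integrable_const r).sub ((integrable_id_gammaMeasure hr hα).const_mul α)
  rw [setIntegral_gammaMeasure hr hα _ measurableSet_Ioi,
    integral_Ioi_of_hasDerivAt_of_tendsto (f := gammaWeight r α) (m := 0) ?_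
      (fun u hu => hasDerivAt_gammaWeight (hx.trans_lt hu))
      ((integrable_gammaMeasure_iff hr hα _).1 hi).integrableOn (tendsto_gammaWeight_atTop hα),
    zero_sub]
  rcases hx.eq_or_lt with h | h
  · subst h; exact continuousWithinAt_gammaWeight_zero hr
  · exact (hasDerivAt_gammaWeight h).continuousAt.continuousWithinAt

lemma integral_id_gammaMeasure (hr : 0 < r) (hα : 0 < α) :
    ∫ u, u ∂gammaMeasure r α = r / α := by
  have := isProbabilityMeasure_gammaMeasure hr hα
  have h := setIntegral_Ioi_sub_gammaMeasure hr hα le_rfl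
  rw [Measure.restrict_eq_self_of_ae_mem (s := Ioi 0) (ae_gammaMeasure_pos r α),
    integral_sub (integrable_const r) ((integrable_id_gammaMeasure hr hα).const_mul α),
    integral_const_mul] at h
  simp [gammaWeight] at h
  field_simp
  linarith

lemma hasDerivAt_setIntegral_Iic_gammaMeasure (hr : 0 < r) (hα : 0 < α) {φ : ℝ → ℝ}
    (hφ : Continuous φ) (hi : Integrable φ (gammaMeasure r α)) {x : ℝ} (hx : 0 < x) :
    HasDerivAt (fun y => ∫ u in Iic y, φ u ∂gammaMeasure r α) (φ x * gammaPDFReal r α x) x := by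
  have hi' := (integrable_gammaMeasure_iff hr hα _).1 hi
  have heq : ∀ y, ∫ u in Iic y, φ u ∂gammaMeasure r α =
      (∫ u in Iic 0, φ u * gammaPDFReal r α u) + ∫ u in (0 : ℝ)..y, φ u * gammaPDFReal r α u := by
    intro y
    rw [setIntegral_gammaMeasure hr hα _ measurableSet_Iic,
      ← intervalIntegral.integral_Iic_sub_Iic hi'.integrableOn hi'.integrableOn]
    ring
  have hc : ContinuousAt (gammaPDFReal r α) x := by
    have : ContinuousAt (fun x : ℝ => gammaWeight r α x / x) x :=
      (hasDerivAt_gammaWeight hx).continuousAt.div continuousAt_id hx.ne'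
    refine this.congr ?_
    filter_upwards [lt_mem_nhds hx] with y hy
    rw [gammaWeight, mul_div_cancel_left₀ _ hy.ne']
  simp only [heq]
  refine (intervalIntegral.integral_hasDerivAt_right hi'.intervalIntegrable ?_
    (hφ.continuousAt.mul hc)).const_add _
  exact ((hφ.measurable.mul
    (measurable_gammaPDFReal r α)).stronglyMeasurable).stronglyMeasurableAtFilter

end GammaLaw

/-! ### A comparison principle for the gamma Stein equation -/

lemma hasDerivAt_rpow_mul_exp (s α : ℝ) {x : ℝ} (hx : 0 < x) :
    HasDerivAt (fun x : ℝ => x ^ s * Real.exp (-α * x))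
      ((s - α * x) * (x ^ (s - 1) * Real.exp (-α * x))) x := by
  have h1 := (Real.hasDerivAt_rpow_const (p := s) (Or.inl hx.ne')).mul
    (((hasDerivAt_id x).const_mul (-α)).exp)
  refine h1.congr_deriv ?_
  have : x ^ s = x * x ^ (s - 1) := by
    rw [Real.rpow_sub_one hx.ne']; field_simp
  simp only [id]
  rw [this]
  ring

/-- The derivative of `x ^ s e^{-αx} (K - c g(x))`, for `g` solving `x g' + (s - αx) g = k`. -/
lemma hasDerivAt_rpow_mul_exp_mul_sub {s α K c x gx' : ℝ} {g k : ℝ → ℝ} (hx : 0 < x)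
    (hg : HasDerivAt g gx' x) (heq : x * gx' + (s - α * x) * g x = k x) :
    HasDerivAt (fun x : ℝ => x ^ s * Real.exp (-α * x) * (K - c * g x))
      (x ^ (s - 1) * Real.exp (-α * x) * ((s - α * x) * K - c * k x)) x := by
  refine ((hasDerivAt_rpow_mul_exp s α hx).mul ((hg.const_mul c).const_sub K)).congr_deriv ?_
  have : x ^ s = x * x ^ (s - 1) := by
    rw [Real.rpow_sub_one hx.ne']; field_simp
  rw [this, ← heq]
  ring

/-- To the left of `s / α` a solution of `x g' + (s - αx) g = k` which is not too singular at `0`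
is bounded by `sup |k| / (s - αx)`. The weight `w = x ^ s e^{-αx}` has `(w g)' = w k / x` and
`w' = (s - αx) w / x`, so this compares the derivatives of `w g` and of `w`. -/
lemma sub_mul_abs_le_of_stein_eq {s α K C : ℝ} {g g' k : ℝ → ℝ} (hα : 0 < α) (hs : 1 < s)
    (hg : ∀ x, 0 < x → HasDerivAt g (g' x) x)
    (heq : ∀ x, 0 < x → x * g' x + (s - α * x) * g x = k x)
    (hk : ∀ x, 0 < x → |k x| ≤ K) (hC : ∀ x, 0 < x → x ≤ 1 → |x * g x| ≤ C) {x : ℝ}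
    (hx : 0 < x) : (s - α * x) * |g x| ≤ K := by
  have hK : 0 ≤ K := (abs_nonneg _).trans (hk x hx)
  rcases le_or_gt (s - α * x) 0 with hc | hc
  · exact (mul_nonpos_of_nonpos_of_nonneg hc (abs_nonneg _)).trans hK
  suffices H : ∀ c, |c| ≤ s - α * x → c * g x ≤ K by
    rcases abs_cases (g x) with ⟨h, _⟩ | ⟨h, _⟩
    · rw [h]; exact H _ (abs_of_pos hc).le
    · rw [h, mul_neg, ← neg_mul]; exact H _ (by rw [abs_neg, abs_of_pos hc])
  intro c hcs
  set φ : ℝ → ℝ := fun x => x ^ s * Real.exp (-α * x) * (K - c * g x) with hφ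
  have hd : ∀ y, 0 < y → HasDerivAt φ _ y := fun y hy =>
    hasDerivAt_rpow_mul_exp_mul_sub hy (hg y hy) (heq y hy)
  have hmono : MonotoneOn φ (Ioc 0 x) := by
    refine monotoneOn_of_deriv_nonneg (convex_Ioc 0 x)
      (fun y hy => (hd y hy.1).continuousAt.continuousWithinAt)
      (fun y hy => (hd y (interior_subset hy).1).differentiableAt.differentiableWithinAt)
      (fun y hy => ?_)
    have hy := interior_subset hy
    have hy0 : 0 < y := hy.1
    rw [(hd y hy0).deriv]
    refine mul_nonneg (by positivity) ?_
    have h1 : c * k y ≤ (s - α * x) * K :=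
      (le_abs_self _).trans (by rw [abs_mul]; exact mul_le_mul hcs (hk y hy0) (abs_nonneg _) hc.le)
    have h2 : (s - α * x) * K ≤ (s - α * y) * K :=
      mul_le_mul_of_nonneg_right (by nlinarith [hy.2]) hK
    linarith
  have hlim : Tendsto φ (𝓝[>] 0) (𝓝 0) := by
    have h1 : Tendsto (fun y : ℝ => y ^ (s - 1)) (𝓝[>] 0) (𝓝 0) := by
      have := (Real.continuous_rpow_const (sub_pos.2 hs).le).tendsto 0
      rw [Real.zero_rpow (sub_pos.2 hs).ne'] at this
      exact this.mono_left nhdsWithin_le_nhds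
    have h2 : Tendsto (fun y : ℝ => y ^ (s - 1) * (K + |c| * C)) (𝓝[>] 0) (𝓝 0) := by
      simpa using h1.mul_const (K + |c| * C)
    refine squeeze_zero_norm' ?_ h2
    filter_upwards [Ioc_mem_nhdsGT (zero_lt_one (α := ℝ))] with y hy
    have hy0 : 0 < y := hy.1
    have : y ^ s = y * y ^ (s - 1) := by
      rw [Real.rpow_sub_one hy0.ne']; field_simp
    have e1 : Real.exp (-α * y) ≤ 1 := Real.exp_le_one_iff.2 (by nlinarith)
    have h4 : |y * (K - c * g y)| ≤ K + |c| * C := by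
      have := hC y hy0 hy.2
      calc |y * (K - c * g y)| = |y * K - c * (y * g y)| := by ring_nf
        _ ≤ |y * K| + |c * (y * g y)| := abs_sub _ _
        _ ≤ _ := by
          rw [abs_mul c, abs_of_nonneg (mul_nonneg hy0.le hK)]
          gcongr
          nlinarith [hy.2]
    have h5 : φ y = y ^ (s - 1) * (Real.exp (-α * y) * (y * (K - c * g y))) := by
      simp only [hφ, this]; ring
    rw [h5, Real.norm_eq_abs, abs_mul, abs_mul, abs_of_nonneg (Real.rpow_nonneg hy0.le _),
      Real.abs_exp]
    refine mul_le_mul_of_nonneg_left ?_ (Real.rpow_nonneg hy0.le _)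
    exact (mul_le_of_le_one_left (abs_nonneg _) e1).trans h4
  have h0 : 0 ≤ φ x := le_of_tendsto hlim <| by
    filter_upwards [Ioc_mem_nhdsGT hx] with y hy
    exact hmono hy (right_mem_Ioc.2 hx) hy.2
  have := nonneg_of_mul_nonneg_right h0 (by positivity)
  linarith

/-- The counterpart of `sub_mul_abs_le_of_stein_eq` to the right of `s / α`, where the weight
decreases and the comparison starts at infinity. -/
lemma mul_sub_abs_le_of_stein_eq {s α K C : ℝ} {g g' k : ℝ → ℝ} (hα : 0 < α)
    (hg : ∀ x, 0 < x → HasDerivAt g (g' x) x)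
    (heq : ∀ x, 0 < x → x * g' x + (s - α * x) * g x = k x)
    (hk : ∀ x, 0 < x → |k x| ≤ K) (hC : ∀ x, 0 < x → |g x| ≤ C) {x : ℝ}
    (hx : 0 < x) : (α * x - s) * |g x| ≤ K := by
  have hK : 0 ≤ K := (abs_nonneg _).trans (hk x hx)
  rcases le_or_gt (α * x - s) 0 with hc | hc
  · exact (mul_nonpos_of_nonpos_of_nonneg hc (abs_nonneg _)).trans hK
  suffices H : ∀ c, |c| ≤ α * x - s → c * g x ≤ K by
    rcases abs_cases (g x) with ⟨h, _⟩ | ⟨h, _⟩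
    · rw [h]; exact H _ (abs_of_pos hc).le
    · rw [h, mul_neg, ← neg_mul]; exact H _ (by rw [abs_neg, abs_of_pos hc])
  intro c hcs
  set φ : ℝ → ℝ := fun x => x ^ s * Real.exp (-α * x) * (K - c * g x) with hφ
  have hd : ∀ y, 0 < y → HasDerivAt φ _ y := fun y hy =>
    hasDerivAt_rpow_mul_exp_mul_sub hy (hg y hy) (heq y hy)
  have hpos : ∀ y ∈ Ici x, 0 < y := fun y hy => hx.trans_le hy
  have hanti : AntitoneOn φ (Ici x) := by
    refine antitoneOn_of_deriv_nonpos (convex_Ici x)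
      (fun y hy => (hd y (hpos y hy)).continuousAt.continuousWithinAt)
      (fun y hy => (hd y (hpos y (interior_subset hy))).differentiableAt.differentiableWithinAt)
      (fun y hy => ?_)
    have hxy : x ≤ y := interior_subset hy
    have hy0 : 0 < y := hx.trans_le hxy
    rw [(hd y hy0).deriv]
    refine mul_nonpos_of_nonneg_of_nonpos (by positivity) ?_
    have h1 : -(c * k y) ≤ (α * x - s) * K :=
      (neg_le_abs _).trans (by rw [abs_mul]; exact mul_le_mul hcs (hk y hy0) (abs_nonneg _) hc.le)
    have h2 : (s - α * y) * K ≤ (s - α * x) * K :=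
      mul_le_mul_of_nonneg_right (by nlinarith) hK
    linarith
  have hlim : Tendsto φ atTop (𝓝 0) := by
    have h2 := (tendsto_rpow_mul_exp_neg_mul_atTop_nhds_zero s α hα).mul_const (K + |c| * C)
    rw [zero_mul] at h2
    refine squeeze_zero_norm' ?_ h2
    filter_upwards [eventually_gt_atTop 0] with y hy
    rw [Real.norm_eq_abs, abs_mul, abs_of_nonneg (by positivity)]
    refine mul_le_mul_of_nonneg_left ?_ (by positivity)
    calc |K - c * g y| ≤ |K| + |c * g y| := abs_sub _ _
      _ ≤ _ := by
        rw [abs_of_nonneg hK, abs_mul]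
        gcongr
        exact hC y hy
  have h0 : 0 ≤ φ x := le_of_tendsto hlim <| by
    filter_upwards [eventually_ge_atTop x] with y hy
    exact hanti (mem_Ici.2 le_rfl) hy hy
  have := nonneg_of_mul_nonneg_right h0 (by positivity)
  linarith

/-! ### Kernel estimates for Lipschitz test functions -/

section Kernel

variable {r α L : ℝ} {h : ℝ → ℝ}

lemma integrable_of_lipschitz {ν : Measure ℝ} [IsFiniteMeasure ν]
    (hi : Integrable (fun x => x) ν) (hc : Continuous h) (hL : ∀ x y, |h x - h y| ≤ L * |x - y|) :
    Integrable h ν := by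
  have h1 : Integrable (fun x : ℝ => |h 0| + L * |x|) ν :=
    (integrable_const _).add (hi.abs.const_mul L)
  refine h1.mono' hc.aestronglyMeasurable (ae_of_all _ fun x => ?_)
  have := hL x 0
  rw [sub_zero] at this
  rw [Real.norm_eq_abs]
  calc |h x| = |h 0 + (h x - h 0)| := by ring_nf
    _ ≤ _ := (abs_add_le _ _).trans (by gcongr)

/-- The estimates for the solution `f = N / q` of the gamma Stein equation, where
`N(x) = ∫_{(0,x]} (h - E h)` and `q(x) = x p(x)`: they say `|f| ≤ L / α` and `|f'| ≤ 2 L`.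
With `A = ∫_{u ≤ x} (h(u) - h(x))`, `B = ∫_{u > x} (h(u) - h(x))` and the distribution function
`F`, one has `N = (1 - F) A - F B`; moreover `|A| ≤ L a` and `|B| ≤ L b`, where `a` and `b` are
the integrals of `|u - x|` over the two half-lines. -/
lemma gamma_kernel_bounds (hr : 0 < r) (hα : 0 < α) (hc : Continuous h)
    (hL : ∀ x y, |h x - h y| ≤ L * |x - y|) {x : ℝ} (hx : 0 < x) :
    |∫ u in Iic x, (h u - ∫ v, h v ∂gammaMeasure r α) ∂gammaMeasure r α| ≤
        L / α * gammaWeight r α x ∧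
      |(h x - ∫ v, h v ∂gammaMeasure r α) * gammaWeight r α x -
        (r - α * x) * ∫ u in Iic x, (h u - ∫ v, h v ∂gammaMeasure r α) ∂gammaMeasure r α| ≤
        2 * L * (x * gammaWeight r α x) := by
  have := isProbabilityMeasure_gammaMeasure hr hα
  have hL0 : 0 ≤ L := by simpa using (abs_nonneg _).trans (hL 1 0)
  have hid := integrable_id_gammaMeasure hr hα
  have hih := integrable_of_lipschitz hid hc hL
  have hmean := integral_id_gammaMeasure hr hα
  have hq := setIntegral_Ioi_sub_gammaMeasure hr hα hx.le
  have hq0 := gammaWeight_pos hr hα hx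
  have hae := ae_gammaMeasure_pos r α
  set γ := gammaMeasure r α
  set q := gammaWeight r α x
  set G := ∫ v, h v ∂γ with hG
  set F := γ.real (Iic x) with hF
  set A := ∫ u in Iic x, (h u - h x) ∂γ with hA
  set B := ∫ u in Ioi x, (h u - h x) ∂γ with hB
  set a := ∫ u in Iic x, (x - u) ∂γ with ha
  set b := ∫ u in Ioi x, (u - x) ∂γ with hb
  have hF0 : 0 ≤ F := measureReal_nonneg
  have hF1 : F ≤ 1 := measureReal_le_one
  have hcompl : γ.real (Ioi x) = 1 - F := by
    rw [← compl_Iic, probReal_compl_eq_one_sub measurableSet_Iic]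
  have hidc : Integrable (fun u => u - x) γ := hid.sub (integrable_const x)
  have hhx : Integrable (fun u => h u - h x) γ := hih.sub (integrable_const _)
  have eAB : A + B = G - h x := by
    rw [hA, hB, ← compl_Iic, integral_add_compl measurableSet_Iic hhx,
      integral_sub hih (integrable_const _)]
    rw [integral_const, probReal_univ, one_smul]
  have eN : ∫ u in Iic x, (h u - G) ∂γ = A + F * (h x - G) := by
    have : (fun u => h u - G) = fun u => (h u - h x) + (h x - G) := by ext; ring
    rw [this]
    rw [integral_add hhx.integrableOn (integrable_const _)]
    simp [hA, hF]
  have eab : b - a = r / α - x := by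
    have : a = -∫ u in Iic x, (u - x) ∂γ := by
      rw [ha, ← integral_neg]; simp
    rw [this, sub_neg_eq_add, add_comm, hb, ← compl_Iic, integral_add_compl measurableSet_Iic hidc,
      integral_sub hid (integrable_const _), hmean, integral_const, probReal_univ, one_smul]
  have eb : α * b = q + (r - α * x) * (1 - F) := by
    have : (fun u => r - α * u) = fun u => (r - α * x) - α * (u - x) := by ext; ring
    rw [this, integral_sub (integrable_const _) (hidc.const_mul α).integrableOn,
      integral_const_mul] at hq
    simp only [integral_const, MeasurableSet.univ, measureReal_restrict_apply, univ_inter,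
      smul_eq_mul, hcompl] at hq
    rw [hb]
    linarith
  have ea : α * a = q - (r - α * x) * F := by
    have : α * (b - a) = r - α * x := by rw [eab]; field_simp
    linarith
  have ha0 : 0 ≤ a := setIntegral_nonneg measurableSet_Iic fun u hu => sub_nonneg.2 hu
  have hb0 : 0 ≤ b := setIntegral_nonneg measurableSet_Ioi fun u hu => sub_nonneg.2 (le_of_lt hu)
  have haF : a ≤ x * F := by
    have h1 : a ≤ ∫ _ in Iic x, x ∂γ := by
      refine setIntegral_mono_ae ((integrable_const x).sub hid).integrableOn
        (integrable_const x).integrableOn ?_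
      filter_upwards [hae] with u hu
      linarith
    refine h1.trans_eq ?_
    simp [hF, mul_comm]
  have hAa : |A| ≤ L * a := by
    rw [ha, ← integral_const_mul]
    refine (abs_integral_le_integral_abs).trans (setIntegral_mono_on hhx.abs.integrableOn
      (((integrable_const x).sub hid).const_mul L).integrableOn measurableSet_Iic fun u hu => ?_)
    refine (hL u x).trans_eq ?_
    rw [abs_sub_comm, abs_of_nonneg (sub_nonneg.2 hu)]
  have hBb : |B| ≤ L * b := by
    rw [hb, ← integral_const_mul]
    refine (abs_integral_le_integral_abs).trans (setIntegral_mono_on hhx.abs.integrableOn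
      (hidc.const_mul L).integrableOn measurableSet_Ioi fun u hu => ?_)
    refine (hL u x).trans_eq ?_
    rw [abs_of_nonneg (sub_nonneg.2 (le_of_lt hu))]
  -- this says that the integral of `u` over `(0, x]` is nonnegative
  have hrF : q ≤ r * F := by
    have : α * a ≤ α * (x * F) := by gcongr
    linarith
  have hab : α * a * b ≤ x * q := by
    rcases le_or_gt (α * x) r with hxr | hxr
    · have h1 : r * (α * a) ≤ α * x * q := by
        rw [ea]; nlinarith [mul_le_mul_of_nonneg_left hrF (sub_nonneg.2 hxr)]
      have h2 : α * b ≤ r := by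
        rw [eb]
        nlinarith [mul_nonneg (mul_pos hα hx).le (sub_nonneg.2 hF1)]
      have h3 : (r * (α * a)) * (α * b) ≤ (α * x * q) * r :=
        mul_le_mul h1 h2 (by positivity) (by positivity)
      have h4 : (r * α) * (α * a * b) ≤ (r * α) * (x * q) := by linarith
      exact le_of_mul_le_mul_left h4 (by positivity)
    · have h1 : a ≤ x := haF.trans (mul_le_of_le_one_right hx.le hF1)
      have h2 : α * b ≤ q := by
        rw [eb]; nlinarith [mul_nonneg (sub_nonneg.2 hxr.le) (sub_nonneg.2 hF1)]
      calc α * a * b = a * (α * b) := by ring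
        _ ≤ x * q := mul_le_mul h1 h2 (by positivity) hx.le
  rw [eN]
  have e1 : A + F * (h x - G) = (1 - F) * A - F * B := by
    linear_combination -F * (-eAB)
  have e2 : (h x - G) * q - (r - α * x) * ((1 - F) * A - F * B) = -(α * b) * A - α * a * B := by
    rw [eb, ea]
    linear_combination -q * (-eAB)
  rw [e1, e2]
  constructor
  · calc |(1 - F) * A - F * B| ≤ |(1 - F) * A| + |F * B| := abs_sub _ _
      _ ≤ (1 - F) * (L * a) + F * (L * b) := by
        rw [abs_mul, abs_mul, abs_of_nonneg hF0, abs_of_nonneg (sub_nonneg.2 hF1)]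
        gcongr
      _ = L / α * ((1 - F) * (α * a) + F * (α * b)) := by field_simp
      _ = L / α * q := by rw [ea, eb]; ring
  · calc |-(α * b) * A - α * a * B| ≤ |-(α * b) * A| + |α * a * B| := abs_sub _ _
      _ ≤ (α * b) * (L * a) + α * a * (L * b) := by
        rw [abs_mul, abs_mul, abs_neg, abs_of_nonneg (mul_nonneg hα.le hb0),
          abs_of_nonneg (mul_nonneg hα.le ha0)]
        gcongr
      _ = 2 * L * (α * a * b) := by ring
      _ ≤ _ := by gcongr

end Kernel

/-! ### The gamma Stein equation -/

/-- The gamma Stein equation on `(0, ∞)`. The bound on `f₂ = f''` comes from `|x f''| ≤ 4 L` when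
`2 αx ≥ r + 2`, and from the twice differentiated equation, of which `f''` is a solution with
parameter `r + 2`, when `2 αx ≤ r + 2`. -/
lemma exists_stein_solution_Ioi {r α L L₂ : ℝ} {h h₁ h₂ : ℝ → ℝ} (hr : 0 < r) (hα : 0 < α)
    (hh : ∀ x, HasDerivAt h (h₁ x) x) (hh₁ : ∀ x, HasDerivAt h₁ (h₂ x) x)
    (hL : ∀ x, |h₁ x| ≤ L) (hL₂ : ∀ x, |h₂ x| ≤ L₂) :
    ∃ f f₁ f₂ : ℝ → ℝ, (∀ x, 0 < x → HasDerivAt f (f₁ x) x) ∧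
      (∀ x, 0 < x → HasDerivAt f₁ (f₂ x) x) ∧
      (∀ x, 0 < x → x * f₁ x + (r - α * x) * f x = h x - ∫ v, h v ∂gammaMeasure r α) ∧
      (∀ x, 0 < x → |f₁ x| ≤ 2 * L) ∧
      ∀ x, 0 < x → |f₂ x| ≤ (2 * L₂ + 8 * α * L) / (r + 2) := by
  have := isProbabilityMeasure_gammaMeasure hr hα
  have hL0 : 0 ≤ L := (abs_nonneg _).trans (hL 0)
  have hL₂0 : 0 ≤ L₂ := (abs_nonneg _).trans (hL₂ 0)
  have hcont : Continuous h := continuous_iff_continuousAt.2 fun x => (hh x).continuousAt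
  have hlip : ∀ x y, |h x - h y| ≤ L * |x - y| := fun x y =>
    Convex.norm_image_sub_le_of_norm_hasDerivWithin_le (s := univ)
      (fun z _ => (hh z).hasDerivWithinAt) (fun z _ => hL z) convex_univ (mem_univ y) (mem_univ x)
  have hint := integrable_of_lipschitz (integrable_id_gammaMeasure hr hα) hcont hlip
  set G := ∫ v, h v ∂gammaMeasure r α
  set N : ℝ → ℝ := fun x => ∫ u in Iic x, (h u - G) ∂gammaMeasure r α with hN
  set q := gammaWeight r α with hq
  have hq0 : ∀ x, 0 < x → 0 < q x := fun x hx => gammaWeight_pos hr hα hx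
  have hNd : ∀ x, 0 < x → HasDerivAt N ((h x - G) * gammaPDFReal r α x) x := fun x hx =>
    hasDerivAt_setIntegral_Iic_gammaMeasure hr hα (hcont.sub continuous_const)
      (hint.sub (integrable_const G)) hx
  set f : ℝ → ℝ := fun x => N x / q x with hf
  set f₁ : ℝ → ℝ := fun x => (h x - G - (r - α * x) * f x) / x with hf₁
  -- the right-hand side of the differentiated equation
  set k : ℝ → ℝ := fun x => h₁ x + α * f x with hk
  set f₂ : ℝ → ℝ := fun x => (k x - (r + 1 - α * x) * f₁ x) / x with hf₂
  have hbound := fun x hx => gamma_kernel_bounds (x := x) hr hα hcont hlip hx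
  have hfb : ∀ x, 0 < x → |α * f x| ≤ L := by
    intro x hx
    have h1 := (hbound x hx).1
    rw [abs_mul, abs_of_pos hα, hf, abs_div, abs_of_pos (hq0 x hx)]
    change |N x| ≤ L / α * q x at h1
    have h2 := hq0 x hx
    calc α * (|N x| / q x) ≤ α * (L / α * q x / q x) := by gcongr
      _ = L := by field_simp
  have hf₁b : ∀ x, 0 < x → |f₁ x| ≤ 2 * L := by
    intro x hx
    have h1 := (hbound x hx).2
    change |(h x - G) * q x - (r - α * x) * N x| ≤ 2 * L * (x * q x) at h1
    have h2 := hq0 x hx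
    have h3 : f₁ x = ((h x - G) * q x - (r - α * x) * N x) / (x * q x) := by
      simp only [hf₁, hf]; field_simp
    rw [h3, abs_div, abs_of_pos (mul_pos hx h2)]
    exact (div_le_iff₀ (mul_pos hx h2)).2 h1
  have hfd : ∀ x, 0 < x → HasDerivAt f (f₁ x) x := by
    intro x hx
    have h2 := hq0 x hx
    have hp : 0 < gammaPDFReal r α x := gammaPDFReal_pos hr hα hx
    refine ((hNd x hx).div (hasDerivAt_gammaWeight hx) h2.ne').congr_deriv ?_
    simp only [hf₁, hf, hq, gammaWeight]
    field_simp
  have hf₁d : ∀ x, 0 < x → HasDerivAt f₁ (f₂ x) x := by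
    intro x hx
    have h1 := ((((hh x).sub_const G).sub
      ((((hasDerivAt_id x).const_mul α).const_sub r).mul (hfd x hx))).div (hasDerivAt_id x) hx.ne')
    refine h1.congr_deriv ?_
    simp only [hf₂, hk, hf₁, id, Pi.sub_apply, Pi.mul_apply]
    field_simp
    ring
  have heq₁ : ∀ x, 0 < x → x * f₂ x + (r + 1 - α * x) * f₁ x = k x := by
    intro x hx
    simp only [hf₂]
    field_simp
    ring
  have hkb : ∀ x, 0 < x → |k x| ≤ 2 * L := fun x hx => by
    have := (abs_add_le (h₁ x) (α * f x)).trans (add_le_add (hL x) (hfb x hx))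
    linarith
  have hxf₂ : ∀ x, 0 < x → |x * f₂ x| ≤ 4 * L := by
    intro x hx
    have h1 : |(r + 1 - α * x) * f₁ x| ≤ 2 * L := by
      rw [abs_mul]
      rcases le_total 0 (r + 1 - α * x) with h | h
      · rw [abs_of_nonneg h]
        refine sub_mul_abs_le_of_stein_eq (C := 2 * L) hα (by linarith) hf₁d heq₁ hkb
          (fun y hy hy1 => ?_) hx
        rw [abs_mul, abs_of_pos hy]
        exact (mul_le_of_le_one_left (abs_nonneg _) hy1).trans (hf₁b y hy)
      · rw [abs_of_nonpos h, neg_sub]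
        exact mul_sub_abs_le_of_stein_eq hα hf₁d heq₁ hkb hf₁b hx
    have h2 : x * f₂ x = k x - (r + 1 - α * x) * f₁ x := by rw [← heq₁ x hx]; ring
    rw [h2]
    linarith [abs_sub (k x) ((r + 1 - α * x) * f₁ x), hkb x hx]
  refine ⟨f, f₁, f₂, hfd, hf₁d, fun x hx => ?_, hf₁b, fun x hx => ?_⟩
  · simp only [hf₁]
    field_simp
    ring
  have hr2 : 0 < r + 2 := by linarith
  rw [le_div_iff₀ hr2]
  rcases le_total (r + 2) (2 * (α * x)) with hxr | hxr
  · have h1 := hxf₂ x hx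
    rw [abs_mul, abs_of_pos hx] at h1
    have h2 : |f₂ x| * (r + 2) ≤ |f₂ x| * (2 * (α * x)) := by gcongr
    have h3 : |f₂ x| * (2 * (α * x)) ≤ 2 * α * (4 * L) := by
      calc |f₂ x| * (2 * (α * x)) = 2 * α * (x * |f₂ x|) := by ring
        _ ≤ _ := by gcongr
    linarith
  · -- the equation is differentiated once more; here `r + 2 - αx ≥ (r + 2) / 2`
    have hf₂d : ∀ y, 0 < y →
        HasDerivAt f₂ ((h₂ y + 2 * α * f₁ y - (r + 2 - α * y) * f₂ y) / y) y := by
      intro y hy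
      have h1 := ((((hh₁ y).add ((hfd y hy).const_mul α)).sub
        ((((hasDerivAt_id y).const_mul α).const_sub (r + 1)).mul (hf₁d y hy))).div
          (hasDerivAt_id y) hy.ne')
      refine h1.congr_deriv ?_
      simp only [hf₂, hk, id, Pi.add_apply, Pi.sub_apply, Pi.mul_apply]
      field_simp
      ring
    have h1 := sub_mul_abs_le_of_stein_eq (s := r + 2) (K := L₂ + 4 * α * L) (C := 4 * L)
      (k := fun y => h₂ y + 2 * α * f₁ y) hα (by linarith) hf₂d
      (fun y hy => by field_simp; ring)
      (fun y hy => by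
        refine (abs_add_le _ _).trans (add_le_add (hL₂ y) ?_)
        rw [abs_mul, abs_of_pos (by positivity)]
        calc 2 * α * |f₁ y| ≤ 2 * α * (2 * L) := by gcongr; exact hf₁b y hy
          _ = _ := by ring)
      (fun y hy _ => hxf₂ y hy) hx
    nlinarith [abs_nonneg (f₂ x)]

/-- The solution of the gamma Stein equation, extended to the real line: the zero biased law tests
functions differentiable on all of `ℝ`, so the Lipschitz function `f'` is extended and integrated. -/
theorem exists_stein_solution {r α L L₂ : ℝ} {h h₁ h₂ : ℝ → ℝ} (hr : 0 < r) (hα : 0 < α)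
    (hh : ∀ x, HasDerivAt h (h₁ x) x) (hh₁ : ∀ x, HasDerivAt h₁ (h₂ x) x)
    (hL : ∀ x, |h₁ x| ≤ L) (hL₂ : ∀ x, |h₂ x| ≤ L₂) :
    ∃ f g : ℝ → ℝ, (∀ x, HasDerivAt f (g x) x) ∧ (∀ x, |g x| ≤ 2 * L) ∧
      (∀ x y, |g x - g y| ≤ (2 * L₂ + 8 * α * L) / (r + 2) * |x - y|) ∧
      ∀ x, 0 ≤ x → x * g x + (r - α * x) * f x = h x - ∫ v, h v ∂gammaMeasure r α := by
  have hL0 : 0 ≤ L := (abs_nonneg _).trans (hL 0)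
  have hL₂0 : 0 ≤ L₂ := (abs_nonneg _).trans (hL₂ 0)
  obtain ⟨f, f₁, f₂, hf, hf₁, heq, hb₁, hb₂⟩ := exists_stein_solution_Ioi hr hα hh hh₁ hL hL₂
  have hM0 : 0 ≤ (2 * L₂ + 8 * α * L) / (r + 2) := by positivity
  have hlip : LipschitzOnWith ((2 * L₂ + 8 * α * L) / (r + 2)).toNNReal f₁ (Ioi 0) := by
    refine LipschitzOnWith.of_dist_le_mul fun x hx y hy => ?_
    rw [Real.coe_toNNReal _ hM0]
    exact Convex.norm_image_sub_le_of_norm_hasDerivWithin_le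
      (fun z hz => (hf₁ z hz).hasDerivWithinAt) (fun z hz => hb₂ z hz) (convex_Ioi 0) hy hx
  obtain ⟨g₀, hg₀, hg₀eq⟩ := hlip.extend_real
  -- clamping preserves the Lipschitz constant and the values on `(0, ∞)`
  set g : ℝ → ℝ := fun x => max (-(2 * L)) (min (2 * L) (g₀ x)) with hg
  have hglip : ∀ x y, |g x - g y| ≤ (2 * L₂ + 8 * α * L) / (r + 2) * |x - y| := by
    intro x y
    have h1 : |g₀ x - g₀ y| ≤ (2 * L₂ + 8 * α * L) / (r + 2) * |x - y| := by
      have := hg₀.dist_le_mul x y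
      rwa [Real.coe_toNNReal _ hM0] at this
    refine le_trans ?_ h1
    refine (abs_max_sub_max_le_max _ _ _ _).trans (max_le (by simp) ?_)
    exact (abs_min_sub_min_le_max _ _ _ _).trans (max_le (by simp) le_rfl)
  have hgb : ∀ x, |g x| ≤ 2 * L := fun x =>
    abs_le.2 ⟨le_max_left _ _, max_le (by linarith) (min_le_left _ _)⟩
  have hgeq : ∀ x, 0 < x → g x = f₁ x := by
    intro x hx
    have := abs_le.1 (hb₁ x hx)
    simp only [hg, ← hg₀eq (mem_Ioi.2 hx)]
    rw [min_eq_right this.2, max_eq_right this.1]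
  have hgc : Continuous g := continuous_const.max (continuous_const.min hg₀.continuous)
  have hFd : ∀ x, HasDerivAt (fun x => f 1 + ∫ t in (1 : ℝ)..x, g t) (g x) x := fun x =>
    (intervalIntegral.integral_hasDerivAt_right (hgc.intervalIntegrable _ _)
      (hgc.stronglyMeasurableAtFilter _ _) hgc.continuousAt).const_add _
  have hFeq : ∀ x, 0 < x → f 1 + ∫ t in (1 : ℝ)..x, g t = f x := by
    intro x hx
    have hpos : ∀ t ∈ uIcc 1 x, 0 < t := fun t ht => (lt_min one_pos hx).trans_le ht.1
    rw [intervalIntegral.integral_eq_sub_of_hasDerivAt (f := f) (fun t ht => ?_)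
      (hgc.intervalIntegrable _ _)]
    · ring
    · rw [hgeq t (hpos t ht)]
      exact hf t (hpos t ht)
  refine ⟨fun x => f 1 + ∫ t in (1 : ℝ)..x, g t, g, hFd, hgb, hglip, fun x hx => ?_⟩
  have hFc : Continuous fun x => f 1 + ∫ t in (1 : ℝ)..x, g t :=
    continuous_iff_continuousAt.2 fun x => (hFd x).continuousAt
  have hhc : Continuous h := continuous_iff_continuousAt.2 fun x => (hh x).continuousAt
  -- both sides are continuous, so the equation extends from `(0, ∞)` to its closure
  have hcl : IsClosed {x | x * g x + (r - α * x) * (f 1 + ∫ t in (1 : ℝ)..x, g t) =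
      h x - ∫ v, h v ∂gammaMeasure r α} := isClosed_eq (by fun_prop) (by fun_prop)
  have hsub : Ioi (0 : ℝ) ⊆ {x | x * g x + (r - α * x) * (f 1 + ∫ t in (1 : ℝ)..x, g t) =
      h x - ∫ v, h v ∂gammaMeasure r α} := fun x hx => by
    rw [mem_ofPred_eq, hFeq x hx, hgeq x hx]
    exact heq x hx
  exact closure_minimal hsub hcl (by rwa [closure_Ioi])

/-! ### Smooth test functions -/

lemma abs_integral_sub_le_of_wassersteinDist_le {ρ ν : Measure ℝ} {θ M : ℝ} (hθ : 0 ≤ θ)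
    (hd : wassersteinDist ρ ν ≤ ENNReal.ofReal θ) (hM : 0 < M) {g : ℝ → ℝ}
    (hg : ∀ x y, |g x - g y| ≤ M * |x - y|) (hρ : Integrable g ρ) (hν : Integrable g ν) :
    |(∫ x, g x ∂ρ) - ∫ x, g x ∂ν| ≤ M * θ := by
  have hlip : (fun x => M⁻¹ * g x) ∈ {f : ℝ → ℝ | ∀ x y, |f x - f y| ≤ |x - y|} := fun x y => by
    rw [← mul_sub, abs_mul, abs_of_pos (inv_pos.2 hM), inv_mul_le_iff₀ hM]
    exact hg x y
  have h1 : ENNReal.ofReal |(∫ x, M⁻¹ * g x ∂ρ) - ∫ x, M⁻¹ * g x ∂ν| ≤ ENNReal.ofReal θ :=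
    le_trans (by
      unfold wassersteinDist ipm
      exact le_iSup₂_of_le (fun x => M⁻¹ * g x) hlip <|
        le_iSup₂_of_le (hρ.const_mul M⁻¹) (hν.const_mul M⁻¹) le_rfl) hd
  rw [ENNReal.ofReal_le_ofReal_iff hθ, integral_const_mul, integral_const_mul, ← mul_sub, abs_mul,
    abs_of_pos (inv_pos.2 hM), inv_mul_le_iff₀ hM] at h1
  exact h1

/-- The heart of the argument: inserting `W` into the Stein equation for `h`, the size and zero
biased laws turn `E[W f'(W) + (r - αW) f(W)]` into `μ (E f'(Wˢ) - E f'(Wᶻ))`, and `f'` is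
Lipschitz. -/
theorem abs_integral_sub_gamma_le {Ω : Type*} [MeasurableSpace Ω] {P : Measure Ω}
    [IsProbabilityMeasure P] {W : Ω → ℝ} (hW : MemLp W 2 P) (hW0 : ∀ᵐ ω ∂P, 0 ≤ W ω)
    {μ v α r : ℝ} (hμ : ∫ ω, W ω ∂P = μ) (hv : 0 < v) (hvar : variance W P = v)
    (hα : α = μ / v) (hr : r = μ ^ 2 / v) (hμ0 : 0 < μ)
    {lawWs lawWz : Measure ℝ} [IsProbabilityMeasure lawWs] [IsProbabilityMeasure lawWz]
    (hs : IsSizeBiased W P lawWs) (hz : IsZeroBiased W P lawWz) {θ : ℝ} (hθ : 0 ≤ θ)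
    (hd : wassersteinDist lawWs lawWz ≤ ENNReal.ofReal θ)
    {L L₂ : ℝ} {h h₁ h₂ : ℝ → ℝ} (hL0 : 0 < L)
    (hh : ∀ x, HasDerivAt h (h₁ x) x) (hh₁ : ∀ x, HasDerivAt h₁ (h₂ x) x)
    (hL : ∀ x, |h₁ x| ≤ L) (hL₂ : ∀ x, |h₂ x| ≤ L₂) :
    |(∫ x, h x ∂P.map W) - ∫ x, h x ∂gammaMeasure r α| ≤
      μ * ((2 * L₂ + 8 * α * L) / (r + 2) * θ) := by
  have hα0 : 0 < α := by rw [hα]; positivity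
  have hr0 : 0 < r := by rw [hr]; positivity
  have hL₂0 : 0 ≤ L₂ := (abs_nonneg _).trans (hL₂ 0)
  obtain ⟨f, g, hf, hgb, hglip, heq⟩ := exists_stein_solution hr0 hα0 hh hh₁ hL hL₂
  set G := ∫ x, h x ∂gammaMeasure r α
  set M := (2 * L₂ + 8 * α * L) / (r + 2) with hM
  have hM0 : 0 < M := by positivity
  have hWi : Integrable W P := hW.integrable one_le_two
  have hWm : AEMeasurable W P := hW.aestronglyMeasurable.aemeasurable
  have hgc : Continuous g := by
    have : LipschitzWith M.toNNReal g := LipschitzWith.of_dist_le_mul fun x y => by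
      rw [Real.coe_toNNReal _ hM0.le]; exact hglip x y
    exact this.continuous
  have hfc : Continuous f := continuous_iff_continuousAt.2 fun x => (hf x).continuousAt
  have hhc : Continuous h := continuous_iff_continuousAt.2 fun x => (hh x).continuousAt
  have hflip : ∀ x, |f x| ≤ |f 0| + 2 * L * |x| := fun x => by
    have h1 : |f x - f 0| ≤ 2 * L * |x - 0| :=
      Convex.norm_image_sub_le_of_norm_hasDerivWithin_le (s := univ)
        (fun z _ => (hf z).hasDerivWithinAt) (fun z _ => hgb z) convex_univ (mem_univ _)
        (mem_univ _)
    rw [sub_zero] at h1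
    calc |f x| = |f 0 + (f x - f 0)| := by ring_nf
      _ ≤ _ := (abs_add_le _ _).trans (by gcongr)
  have hgi : ∀ ν : Measure ℝ, IsProbabilityMeasure ν → Integrable g ν := fun ν _ =>
    (integrable_const (2 * L)).mono' hgc.aestronglyMeasurable (ae_of_all _ hgb)
  have hWg : Integrable (fun ω => W ω * g (W ω)) P :=
    hWi.mul_bdd (c := 2 * L) (hgc.measurable.comp_aemeasurable hWm).aestronglyMeasurable
      (ae_of_all _ fun ω => hgb _)
  have hfW : AEStronglyMeasurable (fun ω => f (W ω)) P :=
    (hfc.measurable.comp_aemeasurable hWm).aestronglyMeasurable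
  have hfi : Integrable (fun ω => f (W ω)) P := by
    refine Integrable.mono' ((integrable_const |f 0|).add (hWi.abs.const_mul (2 * L))) hfW
      (ae_of_all _ fun ω => hflip _)
  have hWf : Integrable (fun ω => W ω * f (W ω)) P := by
    refine Integrable.mono' ((hWi.abs.const_mul |f 0|).add (hW.integrable_sq.const_mul (2 * L)))
      (hW.aestronglyMeasurable.mul hfW) (ae_of_all _ fun ω => ?_)
    simp only [Pi.add_apply, Real.norm_eq_abs, abs_mul]
    have h1 := hflip (W ω)
    have h2 : |W ω| * |f (W ω)| ≤ |W ω| * (|f 0| + 2 * L * |W ω|) := by gcongr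
    rw [← sq_abs (W ω)]
    linarith
  have e1 := (hs g hgc.measurable hWg).2
  have hderiv : deriv f = g := funext fun x => (hf x).deriv
  have e2 := hz f (fun x => (hf x).differentiableAt) hWf (by rw [hderiv]; exact hgi _ inferInstance)
  rw [hderiv, hvar, hμ] at e2
  rw [hμ] at e1
  have e3 : ∫ ω, (W ω - μ) * f (W ω) ∂P =
      (∫ ω, W ω * f (W ω) ∂P) - μ * ∫ ω, f (W ω) ∂P := by
    simp only [sub_mul]
    rw [integral_sub hWf (hfi.const_mul μ), integral_const_mul]
  have e4 : ∫ ω, (h (W ω) - G) ∂P = (∫ ω, W ω * g (W ω) ∂P) +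
      (r * (∫ ω, f (W ω) ∂P) - α * ∫ ω, W ω * f (W ω) ∂P) := by
    rw [← integral_const_mul, ← integral_const_mul,
      ← integral_sub (hfi.const_mul r) (hWf.const_mul α),
      ← integral_add (g := fun ω => r * f (W ω) - α * (W ω * f (W ω))) hWg
        ((hfi.const_mul r).sub (hWf.const_mul α))]
    refine integral_congr_ae ?_
    filter_upwards [hW0] with ω hω
    rw [← heq _ hω]
    ring
  have hhlip : ∀ x y, |h x - h y| ≤ L * |x - y| := fun x y =>
    Convex.norm_image_sub_le_of_norm_hasDerivWithin_le (s := univ)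
      (fun z _ => (hh z).hasDerivWithinAt) (fun z _ => hL z) convex_univ (mem_univ y) (mem_univ x)
  have : IsProbabilityMeasure (P.map W) := Measure.isProbabilityMeasure_map hWm
  have hhi : Integrable (fun ω => h (W ω)) P :=
    (integrable_map_measure hhc.aestronglyMeasurable hWm).1 <| integrable_of_lipschitz
      ((integrable_map_measure (f := W) (g := fun x => x) aestronglyMeasurable_id hWm).2 hWi)
      hhc hhlip
  have e5 : ∫ ω, (h (W ω) - G) ∂P = (∫ x, h x ∂P.map W) - G := by
    rw [integral_sub hhi (integrable_const G), integral_map hWm hhc.aestronglyMeasurable]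
    simp
  have e6 : (∫ x, h x ∂P.map W) - G = μ * ((∫ x, g x ∂lawWs) - ∫ x, g x ∂lawWz) := by
    have hr' : r = α * μ := by rw [hr, hα]; ring
    have hv' : α * v = μ := by rw [hα]; field_simp
    rw [← e5, e4, e1, hr']
    linear_combination α * e3 - α * e2 - (∫ x, g x ∂lawWz) * hv'
  rw [e6, abs_mul, abs_of_pos hμ0]
  exact mul_le_mul_of_nonneg_left (abs_integral_sub_le_of_wassersteinDist_le hθ hd hM0 hglip
    (hgi _ inferInstance) (hgi _ inferInstance)) hμ0.le

/-! ### Smoothing by moving averages -/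

/-- The average of `φ` over the window `[x - b, x]`. -/
noncomputable def movingAvg (b : ℝ) (φ : ℝ → ℝ) (x : ℝ) : ℝ := (∫ t in (x - b)..x, φ t) / b

section MovingAvg

variable {b L : ℝ} {φ : ℝ → ℝ}

lemma hasDerivAt_movingAvg (hφ : Continuous φ) (x : ℝ) :
    HasDerivAt (movingAvg b φ) ((φ x - φ (x - b)) / b) x := by
  have h1 : ∀ y, HasDerivAt (fun y => ∫ t in (0 : ℝ)..y, φ t) (φ y) y := fun y =>
    intervalIntegral.integral_hasDerivAt_right (hφ.intervalIntegrable _ _)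
      (hφ.stronglyMeasurableAtFilter _ _) hφ.continuousAt
  have h2 : movingAvg b φ =
      fun y => ((∫ t in (0 : ℝ)..y, φ t) - ∫ t in (0 : ℝ)..(y - b), φ t) / b := by
    ext y
    rw [movingAvg, intervalIntegral.integral_interval_sub_left (hφ.intervalIntegrable _ _)
      (hφ.intervalIntegrable _ _)]
  rw [h2]
  exact ((h1 x).sub ((h1 (x - b)).comp_sub_const x b)).div_const b

lemma movingAvg_le (hφ : Continuous φ) (hb : 0 < b) {x M : ℝ}
    (h : ∀ t ∈ Icc (x - b) x, φ t ≤ M) : movingAvg b φ x ≤ M := by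
  rw [movingAvg, div_le_iff₀ hb]
  refine (intervalIntegral.integral_mono_on (by linarith) (hφ.intervalIntegrable _ _)
    (continuous_const.intervalIntegrable _ _) h).trans_eq ?_
  simp [mul_comm]

lemma le_movingAvg (hφ : Continuous φ) (hb : 0 < b) {x M : ℝ}
    (h : ∀ t ∈ Icc (x - b) x, M ≤ φ t) : M ≤ movingAvg b φ x := by
  rw [movingAvg, le_div_iff₀ hb]
  refine Eq.trans_le ?_ (intervalIntegral.integral_mono_on (by linarith)
    (continuous_const.intervalIntegrable _ _) (hφ.intervalIntegrable _ _) h)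
  simp [mul_comm]

/-- Averaging a Lipschitz function twice makes it twice differentiable. -/
theorem exists_smoothing (hb : 0 < b) (hL0 : 0 ≤ L) (hφ : ∀ x y, |φ x - φ y| ≤ L * |x - y|) :
    ∃ ψ ψ₁ ψ₂ : ℝ → ℝ, (∀ x, HasDerivAt ψ (ψ₁ x) x) ∧ (∀ x, HasDerivAt ψ₁ (ψ₂ x) x) ∧
      (∀ x, |ψ₁ x| ≤ L) ∧ (∀ x, |ψ₂ x| ≤ 2 * L / b) ∧ (∀ x, |ψ x - φ x| ≤ 2 * b * L) ∧
      (Antitone φ → ∀ x, φ x ≤ ψ x ∧ ψ x ≤ φ (x - 2 * b)) := by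
  have hφc : Continuous φ := by
    have : LipschitzWith L.toNNReal φ := LipschitzWith.of_dist_le_mul fun x y => by
      rw [Real.coe_toNNReal _ hL0]; exact hφ x y
    exact this.continuous
  set φ' := movingAvg b φ
  have hd : ∀ x, HasDerivAt φ' ((φ x - φ (x - b)) / b) x := hasDerivAt_movingAvg hφc
  have hφ'c : Continuous φ' := continuous_iff_continuousAt.2 fun x => (hd x).continuousAt
  have hd1 : ∀ x, |(φ x - φ (x - b)) / b| ≤ L := fun x => by
    rw [abs_div, abs_of_pos hb, div_le_iff₀ hb]
    refine (hφ _ _).trans_eq ?_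
    rw [sub_sub_cancel, abs_of_pos hb]
  have hlip' : ∀ x y, |φ' x - φ' y| ≤ L * |x - y| := fun x y =>
    Convex.norm_image_sub_le_of_norm_hasDerivWithin_le (s := univ)
      (fun z _ => (hd z).hasDerivWithinAt) (fun z _ => hd1 z) convex_univ (mem_univ y) (mem_univ x)
  have hclose : ∀ χ : ℝ → ℝ, Continuous χ → (∀ x y, |χ x - χ y| ≤ L * |x - y|) →
      ∀ x, |movingAvg b χ x - χ x| ≤ b * L := by
    intro χ hc hχ x
    have h1 : ∀ t ∈ Icc (x - b) x, |χ t - χ x| ≤ b * L := fun t ht => by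
      refine (hχ t x).trans ?_
      rw [mul_comm]
      refine mul_le_mul_of_nonneg_right ?_ hL0
      rw [abs_sub_comm, abs_of_nonneg (by linarith [ht.2])]
      linarith [ht.1]
    rw [abs_le]
    constructor
    · have := le_movingAvg hc hb (x := x) (M := χ x - b * L) fun t ht => by
        linarith [(abs_le.1 (h1 t ht)).1]
      linarith
    · have := movingAvg_le hc hb (x := x) (M := χ x + b * L) fun t ht => by
        linarith [(abs_le.1 (h1 t ht)).2]
      linarith
  refine ⟨movingAvg b φ', fun x => (φ' x - φ' (x - b)) / b,
    fun x => ((φ x - φ (x - b)) / b - (φ (x - b) - φ (x - b - b)) / b) / b,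
    hasDerivAt_movingAvg hφ'c, fun x => ?_, fun x => ?_, fun x => ?_, fun x => ?_, fun ha x => ?_⟩
  · exact ((hd x).sub ((hd (x - b)).comp_sub_const x b)).div_const b
  · rw [abs_div, abs_of_pos hb, div_le_iff₀ hb]
    refine (hlip' _ _).trans_eq ?_
    rw [sub_sub_cancel, abs_of_pos hb]
  · rw [abs_div, abs_of_pos hb]
    gcongr
    linarith [abs_sub ((φ x - φ (x - b)) / b) ((φ (x - b) - φ (x - b - b)) / b), hd1 x,
      hd1 (x - b)]
  · have h1 := abs_le.1 (hclose φ' hφ'c hlip' x)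
    have h2 := abs_le.1 (hclose φ hφc hφ x)
    exact abs_le.2 ⟨by linarith [h1.1, h2.1], by linarith [h1.2, h2.2]⟩
  · constructor
    · refine le_movingAvg hφ'c hb fun t ht => (ha ht.2).trans ?_
      exact le_movingAvg hφc hb fun u hu => ha hu.2
    · refine movingAvg_le hφ'c hb fun t ht => movingAvg_le hφc hb fun u hu => ha ?_
      linarith [ht.1, hu.1]

end MovingAvg

/-! ### The modulus of continuity of the gamma distribution function -/

lemma rpow_mul_exp_neg_le {c y : ℝ} (hc : 0 ≤ c) (hy : 0 ≤ y) :
    y ^ c * Real.exp (-y) ≤ (c / Real.exp 1) ^ c := by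
  rcases hc.eq_or_lt with rfl | hc
  · simpa using hy
  have h1 : y / c ≤ Real.exp (y / c - 1) := by linarith [Real.add_one_le_exp (y / c - 1)]
  have h2 : (y / c) ^ c ≤ Real.exp (y - c) := by
    refine (Real.rpow_le_rpow (by positivity) h1 hc.le).trans_eq ?_
    rw [← Real.exp_mul]
    congr 1
    field_simp
  rw [Real.div_rpow hy hc.le, div_le_iff₀ (by positivity)] at h2
  rw [Real.div_rpow hc.le (Real.exp_pos _).le, ← Real.exp_mul, one_mul, le_div_iff₀ (by positivity)]
  calc y ^ c * Real.exp (-y) * Real.exp c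
      ≤ Real.exp (y - c) * c ^ c * Real.exp (-y) * Real.exp c := by gcongr
    _ = c ^ c * Real.exp (y - c + -y + c) := by rw [Real.exp_add, Real.exp_add]; ring
    _ = c ^ c := by rw [show y - c + -y + c = 0 by ring, Real.exp_zero, mul_one]

section GammaCDF

variable {r α : ℝ}

lemma gammaPDFReal_le (hr : 1 ≤ r) (hα : 0 < α) (x : ℝ) :
    gammaPDFReal r α x ≤ α / Real.Gamma r * ((r - 1) / Real.exp 1) ^ (r - 1) := by
  have hΓ := Real.Gamma_pos_of_pos (show 0 < r by linarith)
  have hr1 : 0 ≤ r - 1 := by linarith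
  rw [gammaPDFReal]
  split_ifs with hx
  · have h := rpow_mul_exp_neg_le hr1 (mul_nonneg hα.le hx)
    have h2 : α ^ r = α * α ^ (r - 1) := by rw [Real.rpow_sub_one hα.ne']; field_simp
    calc α ^ r / Real.Gamma r * x ^ (r - 1) * Real.exp (-(α * x))
        = α / Real.Gamma r * ((α * x) ^ (r - 1) * Real.exp (-(α * x))) := by
          rw [h2, Real.mul_rpow hα.le hx]; ring
      _ ≤ _ := by gcongr
  · positivity

lemma gammaMeasure_real_Iic_sub (hr : 0 < r) (hα : 0 < α) {z t : ℝ} (hzt : z ≤ t) :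
    (gammaMeasure r α).real (Iic t) - (gammaMeasure r α).real (Iic z) =
      ∫ x in z..t, gammaPDFReal r α x := by
  have := isProbabilityMeasure_gammaMeasure hr hα
  have h1 : (gammaMeasure r α).real (Iic t) =
      (gammaMeasure r α).real (Iic z) + (gammaMeasure r α).real (Ioc z t) := by
    rw [← measureReal_union (Iic_disjoint_Ioc le_rfl) measurableSet_Ioc, Iic_union_Ioc_eq_Iic hzt]
  have h2 := setIntegral_gammaMeasure hr hα (fun _ => 1) (measurableSet_Ioc (a := z) (b := t))
  rw [intervalIntegral.integral_of_le hzt, h1]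
  simpa using h2

lemma gammaMeasure_real_Iic_sub_le (hr : 1 ≤ r) (hα : 0 < α) {z t : ℝ} (hzt : z ≤ t) :
    (gammaMeasure r α).real (Iic t) - (gammaMeasure r α).real (Iic z) ≤
      α / Real.Gamma r * ((r - 1) / Real.exp 1) ^ (r - 1) * (t - z) := by
  have hr0 : 0 < r := by linarith
  have := isProbabilityMeasure_gammaMeasure hr0 hα
  have hi := (integrable_gammaMeasure_iff hr0 hα _).1 (integrable_const (1 : ℝ))
  simp only [one_mul] at hi
  rw [gammaMeasure_real_Iic_sub hr0 hα hzt]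
  refine (intervalIntegral.integral_mono_on hzt hi.intervalIntegrable
    (continuous_const.intervalIntegrable _ _) fun x _ => gammaPDFReal_le hr hα x).trans_eq ?_
  rw [intervalIntegral.integral_const, smul_eq_mul, mul_comm]

lemma gammaMeasure_real_Iic_sub_le_rpow (hr : 0 < r) (hr1 : r ≤ 1) (hα : 0 < α) {z t : ℝ}
    (hzt : z ≤ t) :
    (gammaMeasure r α).real (Iic t) - (gammaMeasure r α).real (Iic z) ≤
      α ^ r / Real.Gamma r * (t - z) ^ r / r := by
  have hp := isProbabilityMeasure_gammaMeasure hr hα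
  have hi := (integrable_gammaMeasure_iff hr hα _).1 (integrable_const (1 : ℝ))
  simp only [one_mul] at hi
  have hΓ := Real.Gamma_pos_of_pos hr
  -- points below `0` may be moved to `0`
  have hmax : ∀ x, (gammaMeasure r α).real (Iic x) = (gammaMeasure r α).real (Iic (max x 0)) := by
    intro x
    rcases le_total x 0 with hx | hx
    · have h0 := gammaMeasure_Iic_zero r α
      rw [max_eq_right hx, measureReal_def, measureReal_def,
        measure_mono_null (Iic_subset_Iic.2 hx) h0, h0]
    · rw [max_eq_left hx]
  have hz : 0 ≤ max z 0 := le_max_right _ _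
  have hzt' : max z 0 ≤ max t 0 := max_le_max_right 0 hzt
  have hd : max t 0 - max z 0 ≤ t - z := by
    rcases le_total z 0 with h | h
    · rw [max_eq_right h]
      rcases le_total t 0 with h' | h'
      · rw [max_eq_right h']; linarith
      · rw [max_eq_left h']; linarith
    · rw [max_eq_left h, max_eq_left (h.trans hzt)]
  rw [hmax, hmax z, gammaMeasure_real_Iic_sub hr hα hzt']
  have h1 : ∫ x in (max z 0)..(max t 0), gammaPDFReal r α x ≤
      ∫ x in (max z 0)..(max t 0), α ^ r / Real.Gamma r * x ^ (r - 1) := by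
    refine intervalIntegral.integral_mono_on hzt' hi.intervalIntegrable
      ((intervalIntegral.intervalIntegrable_rpow' (by linarith)).const_mul _) fun x hx => ?_
    have hx0 : 0 ≤ x := hz.trans hx.1
    rw [gammaPDFReal, if_pos hx0]
    refine mul_le_of_le_one_right (by positivity) (Real.exp_le_one_iff.2 ?_)
    have := mul_nonneg hα.le hx0
    linarith
  refine h1.trans ?_
  rw [intervalIntegral.integral_const_mul, integral_rpow (Or.inl (by linarith)), sub_add_cancel,
    mul_div_assoc]
  have h2 : (max t 0) ^ r ≤ (max z 0) ^ r + (t - z) ^ r := by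
    have h3 := Real.rpow_add_le_add_rpow hz (sub_nonneg.2 hzt') hr.le hr1
    rw [add_sub_cancel] at h3
    have h4 := Real.rpow_le_rpow (sub_nonneg.2 hzt') hd hr.le
    linarith
  gcongr
  linarith

/-- In terms of the modulus of continuity `u ↦ K u ^ s / s`, with `s = min r 1`, of the gamma
distribution function, the constants for the two ranges of `r` take a common form. -/
lemma exists_gamma_modulus (hr : 0 < r) (hα : 0 < α) {μ : ℝ} (hμ : 0 < μ) :
    ∃ K, 0 < K ∧
      (∀ z t, z ≤ t → (gammaMeasure r α).real (Iic t) - (gammaMeasure r α).real (Iic z) ≤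
        K * (t - z) ^ min r 1 / min r 1) ∧
      kolConstA r α μ = (1 / 2 + 1 / min r 1) * (48 * (μ / (r + 2))) ^ (min r 1 / (min r 1 + 2)) *
        K ^ (2 / (min r 1 + 2)) ∧
      kolConstB r α μ = 8 * α * (μ / (r + 2)) ^ ((min r 1 + 1) / (min r 1 + 2)) *
        (K / 48) ^ (1 / (min r 1 + 2)) := by
  have hΓ := Real.Gamma_pos_of_pos hr
  rcases lt_or_ge r 1 with h | h
  · rw [min_eq_left h.le]
    refine ⟨α ^ r / Real.Gamma r, by positivity,
      fun z t hzt => gammaMeasure_real_Iic_sub_le_rpow hr h.le hα hzt, ?_, ?_⟩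
    · rw [kolConstA, if_pos h, mul_div_assoc]
    · rw [kolConstB, if_pos h, div_div, mul_comm (Real.Gamma r)]
  · rw [min_eq_right h]
    have hK : 0 < α / Real.Gamma r * ((r - 1) / Real.exp 1) ^ (r - 1) := by
      have : 0 < ((r - 1) / Real.exp 1) ^ (r - 1) := by
        rcases h.eq_or_lt with rfl | h
        · simp
        · have : 0 < r - 1 := by linarith
          positivity
      positivity
    have h8 : (8 : ℝ) ^ (1 / 3 : ℝ) = 2 := by
      rw [show (8 : ℝ) = 2 ^ (3 : ℝ) by norm_num, ← Real.rpow_mul (by norm_num)]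
      norm_num
    refine ⟨_, hK, fun z t hzt => ?_, ?_, ?_⟩
    · simpa using gammaMeasure_real_Iic_sub_le h hα hzt
    · rw [kolConstA, if_neg (not_lt.2 h),
        show 48 * (μ / (r + 2)) = 8 * (6 * μ / (r + 2)) by ring,
        Real.mul_rpow (x := 8) (by norm_num) (by positivity), show (1 : ℝ) + 2 = 3 by norm_num, h8]
      ring
    · rw [kolConstB, if_neg (not_lt.2 h)]
      set D := α / Real.Gamma r * ((r - 1) / Real.exp 1) ^ (r - 1) with hD
      have e1 : α / (6 * Real.Gamma r) * ((r - 1) / Real.exp 1) ^ (r - 1) = 8 * (D / 48) := by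
        rw [hD]; field_simp; ring
      rw [e1, Real.mul_rpow (x := 8) (by norm_num) (by positivity), h8]
      norm_num
      ring

end GammaCDF

/-! ### Ramp functions -/

/-- The function equal to `1` on `(-∞, y]`, to `0` on `[y + a, ∞)`, and affine in between. -/
noncomputable def ramp (y a x : ℝ) : ℝ := max 0 (min 1 ((y + a - x) / a))

section Ramp

variable {y a : ℝ}

lemma abs_ramp_sub_le (ha : 0 < a) (x x' : ℝ) : |ramp y a x - ramp y a x'| ≤ 1 / a * |x - x'| := by
  refine (abs_max_sub_max_le_max _ _ _ _).trans (max_le (by simp; positivity) ?_)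
  refine (abs_min_sub_min_le_max _ _ _ _).trans (max_le (by simp; positivity) ?_)
  rw [← sub_div, abs_div, abs_of_pos ha, sub_sub_sub_cancel_left, abs_sub_comm]
  exact (one_div_mul_eq_div _ _).ge

lemma antitone_ramp (ha : 0 < a) : Antitone (ramp y a) := fun x x' h => by
  unfold ramp
  gcongr

lemma ramp_nonneg (x : ℝ) : 0 ≤ ramp y a x := le_max_left _ _

lemma ramp_le_one (x : ℝ) : ramp y a x ≤ 1 := max_le zero_le_one (min_le_left _ _)

lemma ramp_eq_one (ha : 0 < a) {x : ℝ} (hx : x ≤ y) : ramp y a x = 1 := by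
  have : 1 ≤ (y + a - x) / a := by rw [le_div_iff₀ ha]; linarith
  rw [ramp, min_eq_left this, max_eq_right zero_le_one]

lemma ramp_eq_zero (ha : 0 < a) {x : ℝ} (hx : y + a ≤ x) : ramp y a x = 0 := by
  have : (y + a - x) / a ≤ 0 := div_nonpos_of_nonpos_of_nonneg (by linarith) ha.le
  rw [ramp, min_eq_right (by linarith), max_eq_left this]

lemma continuous_ramp (y a : ℝ) : Continuous (ramp y a) := by
  unfold ramp
  fun_prop

/-- A ramp is an average of indicators of half-lines. -/
lemma integral_indicator_Iic_eq_ramp (ha : 0 < a) (x : ℝ) :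
    ∫ t in Ioc y (y + a), (Iic t).indicator (fun _ => (1 : ℝ)) x = a * ramp y a x := by
  have h1 : (fun t => (Iic t).indicator (fun _ => (1 : ℝ)) x) = (Ici x).indicator fun _ => 1 := by
    ext t
    simp [indicator]
  rw [h1, integral_indicator measurableSet_Ici, Measure.restrict_restrict measurableSet_Ici]
  simp only [integral_const, MeasurableSet.univ, measureReal_restrict_apply, univ_inter, smul_eq_mul,
    mul_one]
  rcases le_or_gt x y with hx | hx
  · rw [ramp_eq_one ha hx, inter_eq_right.2 (Ioc_subset_Ioi_self.trans (Ioi_subset_Ici hx)),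
      Real.volume_real_Ioc, max_eq_left (by linarith)]
    ring
  rcases le_or_gt x (y + a) with hx' | hx'
  · have : Ici x ∩ Ioc y (y + a) = Icc x (y + a) := by
      ext t
      exact ⟨fun h => ⟨h.1, h.2.2⟩, fun h => ⟨h.1, hx.trans_le h.1, h.2⟩⟩
    rw [this, Real.volume_real_Icc, max_eq_left (by linarith), ramp, min_eq_right, max_eq_right]
    · field_simp
    · exact div_nonneg (by linarith) ha.le
    · rw [div_le_one ha]; linarith
  · rw [ramp_eq_zero ha hx'.le]
    have : Ici x ∩ Ioc y (y + a) = ∅ := by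
      ext t
      simp only [mem_inter_iff, mem_Ici, mem_Ioc, mem_empty_iff_false, iff_false]
      intro h
      linarith [h.1, h.2.2]
    simp [this]

lemma integral_ramp (ν : Measure ℝ) [IsProbabilityMeasure ν] (ha : 0 < a) :
    a * ∫ x, ramp y a x ∂ν = ∫ t in y..(y + a), ν.real (Iic t) := by
  rw [intervalIntegral.integral_of_le (by linarith), ← integral_const_mul]
  simp_rw [← integral_indicator_Iic_eq_ramp ha]
  rw [integral_integral_swap]
  · refine integral_congr_ae (ae_of_all _ fun t => ?_)
    simp [integral_indicator measurableSet_Iic]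
  · have hm : MeasurableSet {p : ℝ × ℝ | p.1 ≤ p.2} := measurableSet_le measurable_fst measurable_snd
    have : (Function.uncurry fun x t : ℝ => (Iic t).indicator (fun _ => (1 : ℝ)) x) =
        {p : ℝ × ℝ | p.1 ≤ p.2}.indicator fun _ => 1 := by
      ext ⟨x, t⟩
      simp [indicator]
    rw [this]
    exact (integrable_const 1).indicator hm

/-- The tangent line of the concave function `u ↦ u ^ s`. -/
lemma rpow_le_tangent {s ε u : ℝ} (hs : 0 ≤ s) (hs1 : s ≤ 1) (hε : 0 < ε) (hu : 0 ≤ u) :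
    u ^ s ≤ ε ^ s + s * ε ^ (s - 1) * (u - ε) := by
  have h1 := rpow_one_add_le_one_add_mul_self (s := u / ε - 1)
    (by linarith [div_nonneg hu hε.le]) hs hs1
  rw [add_sub_cancel, Real.div_rpow hu hε.le, div_le_iff₀ (by positivity)] at h1
  refine h1.trans_eq ?_
  rw [Real.rpow_sub_one hε.ne']
  field_simp

lemma integral_symm_affine (A B ε c : ℝ) :
    ∫ t in (c - ε / 2)..(c - ε / 2 + ε), (A + B * (t - c)) = ε * A := by
  rw [intervalIntegral.integral_add (by simp)
      (Continuous.intervalIntegrable (by fun_prop) _ _),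
    intervalIntegral.integral_const_mul,
    intervalIntegral.integral_sub (Continuous.intervalIntegrable (by fun_prop) _ _) (by simp),
    integral_id]
  simp only [intervalIntegral.integral_const, smul_eq_mul]
  ring

variable {ν : Measure ℝ} {K s ε : ℝ}

lemma intervalIntegrable_measureReal_Iic (ν : Measure ℝ) [IsProbabilityMeasure ν] (c d : ℝ) :
    IntervalIntegrable (fun t => ν.real (Iic t)) volume c d :=
  Monotone.intervalIntegrable fun _ _ h => measureReal_mono (Iic_subset_Iic.2 h)

/-- The ramp centred at `z + ε`: by concavity of the modulus of continuity, replacing the indicator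
of `(-∞, z]` by this ramp costs no more than shifting it by `ε`. -/
lemma integral_ramp_le [IsProbabilityMeasure ν] (hs : 0 < s) (hs1 : s ≤ 1) (hK : 0 < K)
    (hε : 0 < ε) (hν : ∀ z t, z ≤ t → ν.real (Iic t) - ν.real (Iic z) ≤ K * (t - z) ^ s / s)
    (z : ℝ) : ∫ x, ramp (z + ε / 2) ε x ∂ν ≤ ν.real (Iic z) + K * ε ^ s / s := by
  refine le_of_mul_le_mul_left ?_ hε
  rw [integral_ramp ν hε,
    ← integral_symm_affine (ν.real (Iic z) + K * ε ^ s / s) (K * ε ^ (s - 1)) ε (z + ε),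
    show z + ε - ε / 2 = z + ε / 2 by ring]
  refine intervalIntegral.integral_mono_on (by linarith) (intervalIntegrable_measureReal_Iic ν _ _)
    (Continuous.intervalIntegrable (by fun_prop) _ _) fun t ht => ?_
  have hzt : z ≤ t := by linarith [ht.1]
  have h1 := hν z t hzt
  have h2 := mul_le_mul_of_nonneg_left
    (rpow_le_tangent hs.le hs1 hε (sub_nonneg.2 hzt)) (div_pos hK hs).le
  have h3 : K / s * (ε ^ s + s * ε ^ (s - 1) * (t - z - ε)) =
      K * ε ^ s / s + K * ε ^ (s - 1) * (t - (z + ε)) := by field_simp; ring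
  have h4 : K / s * (t - z) ^ s = K * (t - z) ^ s / s := by ring
  linarith

/-- The counterpart of `integral_ramp_le` for the ramp centred at `z - ε`. -/
lemma le_integral_ramp [IsProbabilityMeasure ν] (hs : 0 < s) (hs1 : s ≤ 1) (hK : 0 < K)
    (hε : 0 < ε) (hν : ∀ z t, z ≤ t → ν.real (Iic t) - ν.real (Iic z) ≤ K * (t - z) ^ s / s)
    (z : ℝ) : ν.real (Iic z) - K * ε ^ s / s ≤ ∫ x, ramp (z - 3 * ε / 2) ε x ∂ν := by
  refine le_of_mul_le_mul_left ?_ hε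
  rw [integral_ramp ν hε,
    ← integral_symm_affine (ν.real (Iic z) - K * ε ^ s / s) (K * ε ^ (s - 1)) ε (z - ε),
    show z - ε - ε / 2 = z - 3 * ε / 2 by ring]
  refine intervalIntegral.integral_mono_on (by linarith)
    (Continuous.intervalIntegrable (by fun_prop) _ _)
    (intervalIntegrable_measureReal_Iic ν _ _) fun t ht => ?_
  have hzt : t ≤ z := by linarith [ht.2]
  have h1 := hν t z hzt
  have h2 := mul_le_mul_of_nonneg_left
    (rpow_le_tangent hs.le hs1 hε (sub_nonneg.2 hzt)) (div_pos hK hs).le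
  have h3 : K / s * (ε ^ s + s * ε ^ (s - 1) * (z - t - ε)) =
      K * ε ^ s / s - K * ε ^ (s - 1) * (t - (z - ε)) := by field_simp; ring
  have h4 : K / s * (z - t) ^ s = K * (z - t) ^ s / s := by ring
  linarith

end Ramp

/-! ### From smooth test functions to the two metrics -/

/-- A comparison of `ρ` and `ν` on smoothed Lipschitz functions: every `L`-Lipschitz `φ` has a
smoothing `ψ` on the scale `b` whose integrals differ by at most `c (4 / b + 8 α) L`. -/
def HasSmoothingBound (ρ ν : Measure ℝ) (c α : ℝ) : Prop :=
  ∀ (φ : ℝ → ℝ) (L b : ℝ), 0 < L → 0 < b → (∀ x y, |φ x - φ y| ≤ L * |x - y|) →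
    ∃ ψ : ℝ → ℝ, Continuous ψ ∧ (∀ x, |ψ x - φ x| ≤ 2 * b * L) ∧
      (Antitone φ → ∀ x, φ x ≤ ψ x ∧ ψ x ≤ φ (x - 2 * b)) ∧
      |(∫ x, ψ x ∂ρ) - ∫ x, ψ x ∂ν| ≤ c * ((4 / b + 8 * α) * L)

section SmoothingBound

variable {ρ ν : Measure ℝ} [IsProbabilityMeasure ρ] [IsProbabilityMeasure ν] {c α : ℝ}

/-- The smoothing scale `b = √c` balances the smoothing error `4 b` and the term `4 c / b`. -/
lemma HasSmoothingBound.abs_integral_sub_le (H : HasSmoothingBound ρ ν c α) (hc : 0 < c)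
    {f : ℝ → ℝ} (hf : ∀ x y, |f x - f y| ≤ |x - y|) (hρ : Integrable f ρ) (hν : Integrable f ν) :
    |(∫ x, f x ∂ρ) - ∫ x, f x ∂ν| ≤ 8 * √c + 8 * α * c := by
  have hb : 0 < √c := Real.sqrt_pos.2 hc
  obtain ⟨ψ, hψ, hclose, -, hbound⟩ := H f 1 (√c) one_pos hb fun x y => by
    rw [one_mul]; exact hf x y
  have hfc : Continuous f := by
    have : LipschitzWith 1 f := LipschitzWith.of_dist_le_mul fun x y => by
      rw [NNReal.coe_one, one_mul]; exact hf x y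
    exact this.continuous
  have key : ∀ κ : Measure ℝ, IsProbabilityMeasure κ → Integrable f κ →
      |(∫ x, ψ x ∂κ) - ∫ x, f x ∂κ| ≤ 2 * √c := by
    intro κ _ hκ
    have hd : Integrable (fun x => ψ x - f x) κ :=
      (integrable_const (2 * √c * 1)).mono' (hψ.sub hfc).aestronglyMeasurable
        (ae_of_all _ hclose)
    have hψi : Integrable ψ κ := (hd.add hκ).congr (ae_of_all _ fun x => sub_add_cancel _ _)
    rw [← integral_sub hψi hκ]
    have := norm_integral_le_of_norm_le_const (μ := κ) (f := fun x => ψ x - f x)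
      (ae_of_all _ hclose)
    simpa using this
  have h1 := abs_le.1 (key ρ inferInstance hρ)
  have h2 := abs_le.1 (key ν inferInstance hν)
  have h3 : c * ((4 / √c + 8 * α) * 1) = 4 * √c + 8 * α * c := by
    have : c / √c = √c := Real.div_sqrt
    calc c * ((4 / √c + 8 * α) * 1) = 4 * (c / √c) + 8 * α * c := by ring
      _ = _ := by rw [this]
  rw [h3] at hbound
  have h4 := abs_le.1 hbound
  exact abs_le.2 ⟨by linarith [h1.2, h2.1, h4.1], by linarith [h1.1, h2.2, h4.2]⟩

/-- The indicator of `(-∞, z]` is squeezed between smoothed ramps on `[z - 3 ε / 2, z]` and on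
`[z, z + 3 ε / 2]`. Smoothing at scale `ε / 4` moves a ramp by at most `ε / 2`, which leaves ramps
centred at `z - ε` and `z + ε` for the comparison under `ν`. -/
lemma HasSmoothingBound.abs_real_Iic_sub_le (H : HasSmoothingBound ρ ν c α) {K s ε : ℝ}
    (hs : 0 < s) (hs1 : s ≤ 1) (hK : 0 < K) (hε : 0 < ε)
    (hν : ∀ z t, z ≤ t → ν.real (Iic t) - ν.real (Iic z) ≤ K * (t - z) ^ s / s) (z : ℝ) :
    |ρ.real (Iic z) - ν.real (Iic z)| ≤ K * ε ^ s / s + (16 * c / ε ^ 2 + 8 * α * c / ε) := by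
  have hb : 0 < ε / 4 := by positivity
  have hL : 0 < 1 / ε := by positivity
  have hconst : c * ((4 / (ε / 4) + 8 * α) * (1 / ε)) = 16 * c / ε ^ 2 + 8 * α * c / ε := by
    field_simp
    ring
  have hshift : ∀ y x, ramp y ε (x - 2 * (ε / 4)) = ramp (y + ε / 2) ε x := fun y x => by
    unfold ramp; ring_nf
  have hramp : ∀ (κ : Measure ℝ) (y : ℝ), IsProbabilityMeasure κ → Integrable (ramp y ε) κ :=
    fun κ y _ => (integrable_const (1 : ℝ)).mono' (continuous_ramp y ε).aestronglyMeasurable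
      (ae_of_all _ fun x => by
        rw [Real.norm_eq_abs, abs_of_nonneg (ramp_nonneg x)]; exact ramp_le_one x)
  have hind : ∀ κ : Measure ℝ, IsProbabilityMeasure κ →
      Integrable ((Iic z).indicator fun _ => (1 : ℝ)) κ := fun κ _ =>
    (integrable_const 1).indicator measurableSet_Iic
  have hreal : ∀ κ : Measure ℝ, ∫ x, (Iic z).indicator (fun _ => (1 : ℝ)) x ∂κ = κ.real (Iic z) :=
    fun κ => by simp [integral_indicator measurableSet_Iic]
  have main : ∀ y, ∃ ψ : ℝ → ℝ, (∀ x, ramp y ε x ≤ ψ x) ∧ (∀ x, ψ x ≤ ramp (y + ε / 2) ε x) ∧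
      Integrable ψ ρ ∧ Integrable ψ ν ∧
      |(∫ x, ψ x ∂ρ) - ∫ x, ψ x ∂ν| ≤ 16 * c / ε ^ 2 + 8 * α * c / ε := by
    intro y
    obtain ⟨ψ, hψ, -, hsand, hbound⟩ := H (ramp y ε) (1 / ε) (ε / 4) hL hb (abs_ramp_sub_le hε)
    have hsand := hsand (antitone_ramp hε)
    simp only [hshift] at hsand
    have hi : ∀ κ : Measure ℝ, IsProbabilityMeasure κ → Integrable ψ κ := fun κ _ =>
      (integrable_const (1 : ℝ)).mono' hψ.aestronglyMeasurable (ae_of_all _ fun x => by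
        rw [Real.norm_eq_abs, abs_of_nonneg ((ramp_nonneg x).trans (hsand x).1)]
        exact (hsand x).2.trans (ramp_le_one x))
    exact ⟨ψ, fun x => (hsand x).1, fun x => (hsand x).2, hi ρ inferInstance, hi ν inferInstance,
      hconst ▸ hbound⟩
  rw [abs_le]
  constructor
  · obtain ⟨ψ, h1, h2, hiρ, hiν, hbound⟩ := main (z - 3 * ε / 2)
    have e1 : ∫ x, ψ x ∂ρ ≤ ρ.real (Iic z) := by
      rw [← hreal]
      refine integral_mono hiρ (hind ρ inferInstance) fun x => (h2 x).trans ?_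
      rcases le_or_gt x z with hx | hx
      · rw [indicator_of_mem (mem_Iic.2 hx)]; exact ramp_le_one x
      · rw [indicator_of_notMem (notMem_Iic.2 hx), ramp_eq_zero hε (by linarith)]
    have e2 := integral_mono (hramp ν _ inferInstance) hiν h1
    have e3 := le_integral_ramp hs hs1 hK hε hν z
    have e4 := abs_le.1 hbound
    linarith [e4.1]
  · obtain ⟨ψ, h1, h2, hiρ, hiν, hbound⟩ := main z
    have e1 : ρ.real (Iic z) ≤ ∫ x, ψ x ∂ρ := by
      rw [← hreal]
      refine integral_mono (hind ρ inferInstance) hiρ fun x => le_trans ?_ (h1 x)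
      rcases le_or_gt x z with hx | hx
      · rw [indicator_of_mem (mem_Iic.2 hx), ramp_eq_one hε hx]
      · rw [indicator_of_notMem (notMem_Iic.2 hx)]; exact ramp_nonneg x
    have e2 := integral_mono hiν (hramp ν _ inferInstance) h2
    have e3 := integral_ramp_le hs hs1 hK hε hν z
    have e4 := abs_le.1 hbound
    linarith [e4.2]

/-- The Kolmogorov bound with the width `ε` chosen by `ε ^ (s + 2) = 48 c / K`, for which
`24 c / ε ^ 2 = K ε ^ s / 2`. -/
lemma HasSmoothingBound.abs_real_Iic_sub_le_optimized (H : HasSmoothingBound ρ ν c α) {K s : ℝ}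
    (hc : 0 < c) (hs : 0 < s) (hs1 : s ≤ 1) (hK : 0 < K)
    (hν : ∀ z t, z ≤ t → ν.real (Iic t) - ν.real (Iic z) ≤ K * (t - z) ^ s / s) (z : ℝ) :
    |ρ.real (Iic z) - ν.real (Iic z)| ≤
      (1 / 2 + 1 / s) * (48 * c) ^ (s / (s + 2)) * K ^ (2 / (s + 2)) +
        8 * α * c ^ ((s + 1) / (s + 2)) * (K / 48) ^ (1 / (s + 2)) := by
  have hs2 : s + 2 ≠ 0 := by positivity
  set ε := (48 * c / K) ^ (1 / (s + 2)) with hε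
  have hε0 : 0 < ε := by positivity
  refine (H.abs_real_Iic_sub_le hs hs1 hK hε0 hν z).trans ?_
  have e1 : K * ε ^ s = (48 * c) ^ (s / (s + 2)) * K ^ (2 / (s + 2)) := by
    rw [hε, ← Real.rpow_mul (by positivity), Real.div_rpow (by positivity) hK.le,
      show 2 / (s + 2) = 1 - s / (s + 2) by field_simp; ring, Real.rpow_sub hK, Real.rpow_one,
      show 1 / (s + 2) * s = s / (s + 2) by ring]
    ring
  have e2 : 48 * c = K * ε ^ s * ε ^ 2 := by
    have : ε ^ s * ε ^ 2 = 48 * c / K := by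
      rw [← Real.rpow_natCast ε 2, ← Real.rpow_add hε0, hε, ← Real.rpow_mul (by positivity)]
      norm_num
      rw [inv_mul_cancel₀ hs2, Real.rpow_one]
    rw [mul_assoc, this]
    field_simp
  have e3 : 16 * c / ε ^ 2 ≤ K * ε ^ s / 2 := by
    rw [div_le_iff₀ (by positivity)]
    linarith
  have e4 : c / ε = c ^ ((s + 1) / (s + 2)) * (K / 48) ^ (1 / (s + 2)) := by
    have h1 : 48 * c / K = c / (K / 48) := by field_simp
    rw [hε, h1, Real.div_rpow hc.le (by positivity),
      show (s + 1) / (s + 2) = 1 - 1 / (s + 2) by field_simp; ring, Real.rpow_sub hc, Real.rpow_one]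
    field_simp
  calc K * ε ^ s / s + (16 * c / ε ^ 2 + 8 * α * c / ε)
      ≤ K * ε ^ s / s + (K * ε ^ s / 2 + 8 * α * c / ε) := by gcongr
    _ = (1 / 2 + 1 / s) * (K * ε ^ s) + 8 * α * (c / ε) := by ring
    _ = _ := by rw [e1, e4]; ring

end SmoothingBound

/-- Passage to the limit `t ↓ θ` in a bound by powers of `t`. -/
lemma ofReal_le_of_forall_lt {x A B p q θ : ℝ} (hA : 0 ≤ A) (hB : 0 ≤ B) (hp : 0 < p) (hq : 0 < q)
    (hθ : 0 ≤ θ) (h : ∀ t, θ < t → x ≤ A * t ^ p + B * t ^ q) :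
    ENNReal.ofReal x ≤ ENNReal.ofReal A * ENNReal.ofReal θ ^ p +
      ENNReal.ofReal B * ENNReal.ofReal θ ^ q := by
  rw [ENNReal.ofReal_rpow_of_nonneg hθ hp.le, ENNReal.ofReal_rpow_of_nonneg hθ hq.le,
    ← ENNReal.ofReal_mul hA, ← ENNReal.ofReal_mul hB,
    ← ENNReal.ofReal_add (by positivity) (by positivity)]
  refine ENNReal.ofReal_le_ofReal ?_
  have hc : Continuous fun t : ℝ => A * t ^ p + B * t ^ q := by
    have h1 := Real.continuous_rpow_const hp.le
    have h2 := Real.continuous_rpow_const hq.le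
    fun_prop
  have ht : Tendsto (fun t : ℝ => A * t ^ p + B * t ^ q) (𝓝[>] θ) (𝓝 (A * θ ^ p + B * θ ^ q)) :=
    (hc.tendsto θ).mono_left nhdsWithin_le_nhds
  exact ge_of_tendsto ht (eventually_nhdsWithin_of_forall h)

lemma integral_pos_of_variance_pos {Ω : Type*} [MeasurableSpace Ω] {P : Measure Ω}
    [IsProbabilityMeasure P] {W : Ω → ℝ} (hW : MemLp W 2 P) (hW0 : ∀ᵐ ω ∂P, 0 ≤ W ω)
    (hv : 0 < variance W P) : 0 < ∫ ω, W ω ∂P := by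
  refine (integral_nonneg_of_ae hW0).lt_of_ne fun h => hv.ne' ?_
  have h0 := (integral_eq_zero_iff_of_nonneg_ae hW0 (hW.integrable one_le_two)).1 h.symm
  rw [variance_eq_integral hW.aestronglyMeasurable.aemeasurable, ← h]
  refine integral_eq_zero_of_ae ?_
  filter_upwards [h0] with ω hω
  simp [hω]

/-! ### Gamma approximation -/

theorem mainTheorem2 {Ω : Type*} [MeasurableSpace Ω] (P : Measure Ω) [IsProbabilityMeasure P]
    (W : Ω → ℝ) (hW : MemLp W 2 P) (hW0 : ∀ᵐ ω ∂P, 0 ≤ W ω)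
    (μ σ α r : ℝ) (hμ : ∫ ω, W ω ∂P = μ) (hσ : 0 < σ) (hvar : variance W P = σ ^ 2)
    (hα : α = μ / σ ^ 2) (hr : r = μ ^ 2 / σ ^ 2)
    (lawWs lawWz : Measure ℝ) [IsProbabilityMeasure lawWs] [IsProbabilityMeasure lawWz]
    (hs : IsSizeBiased W P lawWs) (hz : IsZeroBiased W P lawWz)
    (Θ : ℝ≥0∞) (hΘ : Θ = wassersteinDist lawWs lawWz) :
    wassersteinDist (P.map W) (gammaMeasure r α) ≤
        ENNReal.ofReal (8 * √(3 * μ / (r + 2))) * Θ ^ (1 / 2 : ℝ) +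
          ENNReal.ofReal (8 * r / (r + 2)) * Θ ∧
      kolmogorovDist (P.map W) (gammaMeasure r α) ≤
        ENNReal.ofReal (kolConstA r α μ) * Θ ^ (min r 1 / (min r 1 + 2)) +
          ENNReal.ofReal (kolConstB r α μ) * Θ ^ ((min r 1 + 1) / (min r 1 + 2)) := by
  have hμ0 : 0 < μ := hμ ▸ integral_pos_of_variance_pos hW hW0 (hvar ▸ by positivity)
  have hα0 : 0 < α := by rw [hα]; positivity
  have hr0 : 0 < r := by rw [hr]; positivity
  have hs0 : 0 < min r 1 := lt_min hr0 one_pos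
  obtain ⟨K, hK, hmod, hA, hB⟩ := exists_gamma_modulus hr0 hα0 hμ0
  have hA0 : 0 < kolConstA r α μ := by rw [hA]; positivity
  have hB0 : 0 ≤ kolConstB r α μ := by rw [hB]; positivity
  have hp0 : 0 < min r 1 / (min r 1 + 2) := by positivity
  have hq0 : 0 < (min r 1 + 1) / (min r 1 + 2) := by positivity
  have hA0' : 0 < 8 * √(3 * μ / (r + 2)) := by positivity
  rcases eq_or_ne Θ ⊤ with htop | htop
  · rw [htop, ENNReal.top_rpow_of_pos (by norm_num), ENNReal.top_rpow_of_pos hp0,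
      ENNReal.mul_top (ENNReal.ofReal_pos.2 hA0').ne',
      ENNReal.mul_top (ENNReal.ofReal_pos.2 hA0).ne',
      top_add, top_add]
    exact ⟨le_top, le_top⟩
  have hWm : AEMeasurable W P := hW.aestronglyMeasurable.aemeasurable
  have hρ : IsProbabilityMeasure (P.map W) := Measure.isProbabilityMeasure_map hWm
  have hγ := isProbabilityMeasure_gammaMeasure hr0 hα0
  -- the bounds are shown with any `t > Θ` in place of `Θ`, which avoids the division by `Θ = 0` in
  -- the choice of the smoothing scale; then `t → Θ`
  have H : ∀ t, Θ.toReal < t →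
      HasSmoothingBound (P.map W) (gammaMeasure r α) (μ / (r + 2) * t) α := by
    intro t ht φ L b hL hb hφ
    have ht0 : 0 ≤ t := ENNReal.toReal_nonneg.trans ht.le
    have hd : wassersteinDist lawWs lawWz ≤ ENNReal.ofReal t := by
      rw [← hΘ, ← ENNReal.ofReal_toReal htop]
      exact ENNReal.ofReal_le_ofReal ht.le
    obtain ⟨ψ, ψ₁, ψ₂, h1, h2, h3, h4, h5, h6⟩ := exists_smoothing hb hL.le hφ
    refine ⟨ψ, continuous_iff_continuousAt.2 fun x => (h1 x).continuousAt, h5, h6, ?_⟩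
    refine (abs_integral_sub_gamma_le hW hW0 hμ (by positivity) hvar hα hr hμ0 hs hz ht0 hd hL
      h1 h2 h3 h4).trans_eq ?_
    field_simp
    ring
  have htop' : ENNReal.ofReal Θ.toReal = Θ := ENNReal.ofReal_toReal htop
  constructor
  · refine iSup₂_le fun f hf => iSup₂_le fun hfρ hfγ => ?_
    have := ofReal_le_of_forall_lt (x := |(∫ x, f x ∂P.map W) - ∫ x, f x ∂gammaMeasure r α|)
      hA0'.le (show 0 ≤ 8 * r / (r + 2) by positivity) (p := 1 / 2) (q := 1) (by norm_num) one_pos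
      (ENNReal.toReal_nonneg (a := Θ)) fun t ht => ?_
    · rwa [htop', ENNReal.rpow_one] at this
    have ht0 : 0 < t := ENNReal.toReal_nonneg.trans_lt ht
    refine ((H t ht).abs_integral_sub_le (by positivity) hf hfρ hfγ).trans ?_
    have hr' : r = α * μ := by rw [hr, hα]; ring
    have e1 : √(μ / (r + 2) * t) ≤ √(3 * μ / (r + 2)) * t ^ (1 / 2 : ℝ) := by
      rw [← Real.sqrt_eq_rpow, ← Real.sqrt_mul (by positivity)]
      gcongr
      linarith
    have e2 : 8 * α * (μ / (r + 2) * t) = 8 * r / (r + 2) * t ^ (1 : ℝ) := by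
      rw [Real.rpow_one]
      nth_rewrite 2 [hr']
      ring
    rw [e2]
    linarith
  · refine iSup₂_le fun f hf => iSup₂_le fun _ _ => ?_
    obtain ⟨z, rfl⟩ := hf
    rw [← htop']
    refine ofReal_le_of_forall_lt hA0.le hB0 hp0 hq0 ENNReal.toReal_nonneg fun t ht => ?_
    have ht0 : 0 < t := ENNReal.toReal_nonneg.trans_lt ht
    rw [integral_indicator measurableSet_Iic, integral_indicator measurableSet_Iic]
    simp only [integral_const, MeasurableSet.univ, measureReal_restrict_apply, univ_inter,
      smul_eq_mul, mul_one]
    refine ((H t ht).abs_real_Iic_sub_le_optimized (by positivity) hs0 (min_le_right _ _) hK hmod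
      z).trans_eq ?_
    rw [hA, hB, ← mul_assoc 48 (μ / (r + 2)) t, Real.mul_rpow (by positivity) ht0.le,
      Real.mul_rpow (by positivity) ht0.le]
    ring
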